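/- Conventions. Units are such that $[\hat x,\hat p]=i$; the Hilbert space of $n$ modes is $L^2(\mathbb R^n)$. Fix $s>0$ and $\gamma\in\mathbb R$, let $|\gamma\rangle_s$ be the single-mode state with wavefunction $e^{i\gamma x^3}e^{-x^2/(2s^2)}/(\sqrt s\,\pi^{1/4})$, and let $\sigma=(|\gamma\rangle_s\langle\gamma|_s)^{\otimes M}$, $M\ge 1$, be the ideal resource state. Let $$\mathcal W=\Bigl(1+\tfrac M2\Bigr)\mathbb 1+\sum_{k=1}^{M}\sum_{a=1}^{6}\lambda_a f_a^{(k)},$$ where $f_1,\dots,f_6=\hat x^2,\ \hat x^4,\ \hat p^2,\ \hat p^3,\ (\hat x-\hat p)^3,\ (\hat x+\hat p)^3$, where $\lambda_1,\dots,\lambda_6=-\frac1{2s^2},\ -\frac{9\gamma^2s^2}2,\ -\frac{s^2}2,\ -\gamma s^2,\ -\frac{\gamma s^2}2,\ \frac{\gamma s^2}2$, and where $f_a^{(k)}$ acts on mode $k$. Protocol. Alice chooses a threshold fidelity $0<F_T<1$, a significance level $0<\beta<1$ and an estimation error $0<\eta\le(1-F_T)/2$. Bob sends $N+1$ independent identical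 copies of an $M$-mode state $\rho$ (a density operator). On each of $N$ copies Alice draws a pair $(k,a)$ with probability $|\lambda_a|/\Lambda$, where $\Lambda=M\sum_a|\lambda_a|$, and measures $f_a^{(k)}$ by homodyne detection, with result $f$; $F_{\mathrm{low}}^{\mathrm{(est)}}$ is $1+\frac M2$ plus the sample mean of $\Lambda\,\mathrm{sign}(\lambda_a)f$. She accepts if and only if $F_{\mathrm{low}}^{\mathrm{(est)}}\ge F_T+\eta$. The last copy of $\rho$ serves as resource for her computation on an $m$-mode pure input state, which consists of unitary gates on her $m$ modes and $M$ cubic phase gates of nonzero strengths $\gamma_j=r_j^3\gamma$, $r_j\in\mathbb R\setminus\{0\}$, on modes $k_j$. (In the protocol the input and Alice's gates are Gaussian; the claim holds for any input and any unitary gates.) The $j$-th cubic phase gate is done by teleportation, that is by the following steps: squeezing $S(r_j)$ of mode $k_j$, where $S(r)^\dagger\hat xS(r)=r\hat x$; the gate $e^{i\hat x\otimes\hat p}$ between mode $k_j$ and the $j$-th mode of the resource; measurement of $\hat x$ on the latter, with outcome $x_j$; the correction $e^{-i\gamma x_j^3}e^{-3i\gamma x_j\hat x(\hat x+x_j)}$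 on mode $k_j$; and $S(r_j)^\dagger$. For each outcome $(x_1,\dots,x_M)$ let $|\Psi_{\mathrm{out}}\rangle$ be the normalized output that the ideal resource $\sigma$ gives for this outcome. The output is incorrect if the measurement $\{|\Psi_{\mathrm{out}}\rangle\langle\Psi_{\mathrm{out}}|,\ \mathbb 1-|\Psi_{\mathrm{out}}\rangle\langle\Psi_{\mathrm{out}}|\}$ on the actual output gives the second result; probabilities include the randomness of $(x_1,\dots,x_M)$. Finite energy. A state $\rho$ has energy at most $E$ per mode if $\operatorname{Tr}\bigl((f_a^{(k)})^2\rho\bigr)\le E$ for all $k$ and $a$. Theorem 2. For all $s>0$, $\gamma\in\mathbb R$ and $E\in\mathbb R$ there is a constant $C>0$ such that the following holds for all $m,M,N,F_T,\beta,\eta$ and all computations as above. Suppose that $$N\ \ge\ C\,\frac{M^2}{\eta^2}\,\ln\frac8\beta ,$$ or that $N$ is such that $\Pr\bigl(|F_{\mathrm{low}}^{\mathrm{(est)}}-\operatorname{Tr}(\mathcal W\rho)|<\eta\bigr)\ge1-\beta$ for every $\rho$ of energy at most $E$ per mode. Then the assisted computation is $\varepsilon$-verifiable with $\varepsilon=1-(1-\beta)F_T$: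 we have $0\le\varepsilon\le1$, and, for every $\rho$ of energy at most $E$ per mode, the joint probability that Alice accepts and that the output is incorrect is at most $\varepsilon$. -/

import Mathlib

open MeasureTheory
open scoped ENNReal FourierTransform InnerProductSpace

noncomputable section

namespace CVVerify

/-! ### Modes, wavefunctions, tensor products -/

/-- Position configurations of `n` modes, with Lebesgue measure. -/
abbrev Config (n : ℕ) := EuclideanSpace ℝ (Fin n)

/-- The Hilbert space of `n` modes in position representation, `L²(ℝⁿ)`. -/
abbrev Wave (n : ℕ) := Lp ℂ 2 (volume : Measure (Config n))

/-- The joint Hilbert space `L²(ℝᵐ × ℝᴹ)` of Alice's `m`-mode register and the `M`-mode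
resource register. -/
abbrev Joint (m M : ℕ) := Lp ℂ 2 (volume : Measure (Config m × Config M))

instance (m M : ℕ) : (volume : Measure (Config m × Config M)).IsAddHaarMeasure :=
  inferInstanceAs
    ((volume : Measure (Config m)).prod (volume : Measure (Config M))).IsAddHaarMeasure

lemma memLp_tensor {m M : ℕ} (ψ : Wave m) (φ : Wave M) :
    MemLp (fun z : Config m × Config M => ψ z.1 * φ z.2) 2 volume := by
  have h1 := Lp.memLp ψ
  have h2 := Lp.memLp φ
  have hm : AEStronglyMeasurable (fun z : Config m × Config M => ψ z.1 * φ z.2) volume :=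
    (h1.1.comp_fst).mul (h2.1.comp_snd)
  rw [memLp_two_iff_integrable_sq_norm hm]
  have := ((memLp_two_iff_integrable_sq_norm h1.1).1 h1).mul_prod
    ((memLp_two_iff_integrable_sq_norm h2.1).1 h2)
  simp only [norm_mul, mul_pow]
  exact this

/-- The product vector `ψ ⊗ φ`. -/
def tensor {m M : ℕ} (ψ : Wave m) (φ : Wave M) : Joint m M := (memLp_tensor ψ φ).toLp _

/-! ### Elementary unitaries -/

section Elementary

variable {X : Type*} [MeasurableSpace X] {μ : Measure X}

lemma memLp_phase {θ : X → ℝ} (hθ : Measurable θ) (f : Lp ℂ 2 μ) :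
    MemLp (fun x => Complex.exp (Complex.I * θ x) * f x) 2 μ := by
  refine MemLp.of_le (Lp.memLp f) ?_ (Filter.Eventually.of_forall fun x => ?_)
  · exact (Measurable.aestronglyMeasurable (by fun_prop)).mul (Lp.memLp f).1
  · rw [norm_mul, mul_comm Complex.I, Complex.norm_exp_ofReal_mul_I, one_mul]

/-- Multiplication by the phase `exp(i θ(x))`, that is the unitary `exp(i θ(x̂))`. -/
def phase (θ : X → ℝ) (hθ : Measurable θ) (f : Lp ℂ 2 μ) : Lp ℂ 2 μ :=
  (memLp_phase hθ f).toLp _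

end Elementary

section Substitution

variable {X : Type*} [NormedAddCommGroup X] [NormedSpace ℝ X] [FiniteDimensional ℝ X]
  [MeasurableSpace X] [BorelSpace X] {μ : Measure X} [μ.IsAddHaarMeasure]

lemma memLp_substitute (T : X ≃ₗ[ℝ] X) (f : Lp ℂ 2 μ) :
    MemLp (fun x => (Real.sqrt |LinearMap.det (T : X →ₗ[ℝ] X)| : ℂ) * f (T x)) 2 μ := by
  have hdet : LinearMap.det (T : X →ₗ[ℝ] X) ≠ 0 := T.isUnit_det'.ne_zero
  have hmeas : Measurable T := T.toContinuousLinearEquiv.continuous.measurable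
  have hmap : MeasurePreserving T μ
      (ENNReal.ofReal |(LinearMap.det (T : X →ₗ[ℝ] X))⁻¹| • μ) :=
    ⟨hmeas, Measure.map_linearMap_addHaar_eq_smul_addHaar μ hdet⟩
  exact (((Lp.memLp f).smul_measure ENNReal.ofReal_ne_top).comp_measurePreserving hmap).const_mul _

/-- The unitary change of variables `f ↦ |det T|^{1/2} f ∘ T` of a linear automorphism `T`. -/
def substitute (T : X ≃ₗ[ℝ] X) (f : Lp ℂ 2 μ) : Lp ℂ 2 μ := (memLp_substitute T f).toLp _

end Substitution

/-! ### Mixed states -/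

section States

variable (H : Type*) [NormedAddCommGroup H] [InnerProductSpace ℂ H] [CompleteSpace H]

/-- The index set of a fixed orthonormal basis of `H`. -/
def basisIndex : Set H := (exists_hilbertBasis ℂ H).choose

/-- A fixed orthonormal (Hilbert) basis of `H`. -/
def basis : HilbertBasis (basisIndex H) ℂ H := (exists_hilbertBasis ℂ H).choose_spec.choose

/-- A density operator: a positive operator whose trace is `1`. -/
structure DensityOperator where
  /-- the operator -/
  op : H →L[ℂ] H
  isPositive : op.IsPositive
  trace_eq_one : HasSum (fun i => ⟪basis H i, op (basis H i)⟫_ℂ) 1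

variable {H}

/-- The vectors `√ρ eᵢ`; they satisfy `ρ = ∑ᵢ |√ρ eᵢ⟩⟨√ρ eᵢ|` (see `DensityOperator.hasSum_vec`),
so that `Tr(A ρ A†) = ∑ᵢ ‖A √ρ eᵢ‖²`. -/
def DensityOperator.vec (ρ : DensityOperator H) (i : basisIndex H) : H :=
  (CFC.sqrt ρ.op) (basis H i)

lemma DensityOperator.hasSum_vec (ρ : DensityOperator H) (f g : H) :
    HasSum (fun i => ⟪g, ρ.vec i⟫_ℂ * ⟪ρ.vec i, f⟫_ℂ) ⟪g, ρ.op f⟫_ℂ := by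
  have h0 : (0 : H →L[ℂ] H) ≤ ρ.op := (ContinuousLinearMap.nonneg_iff_isPositive _).2 ρ.isPositive
  have hsq : CFC.sqrt ρ.op * CFC.sqrt ρ.op = ρ.op := CFC.sqrt_mul_sqrt_self ρ.op h0
  have hS : (CFC.sqrt ρ.op).IsPositive :=
    (ContinuousLinearMap.nonneg_iff_isPositive _).1 (CFC.sqrt_nonneg ρ.op)
  have hsym : ∀ u v : H, ⟪(CFC.sqrt ρ.op) u, v⟫_ℂ = ⟪u, (CFC.sqrt ρ.op) v⟫_ℂ :=
    hS.isSymmetric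
  have h := (basis H).hasSum_inner_mul_inner ((CFC.sqrt ρ.op) g) ((CFC.sqrt ρ.op) f)
  have e : ⟪(CFC.sqrt ρ.op) g, (CFC.sqrt ρ.op) f⟫_ℂ = ⟪g, ρ.op f⟫_ℂ := by
    rw [hsym, ← mul_apply_eq_comp, hsq]
  rw [e] at h
  have e' : (fun i => ⟪g, ρ.vec i⟫_ℂ * ⟪ρ.vec i, f⟫_ℂ) = fun i =>
      ⟪(CFC.sqrt ρ.op) g, basis H i⟫_ℂ * ⟪basis H i, (CFC.sqrt ρ.op) f⟫_ℂ := by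
    funext i
    rw [DensityOperator.vec, hsym g, hsym (basis H i)]
  rw [e']
  exact h

end States

/-! ### Homodyne detection -/

/-- The homodyne bases: the single-mode quadratures `x̂`, `p̂`, `x̂ - p̂`, `x̂ + p̂`. -/
inductive Quadrature
  | x
  | p
  | xSubP
  | xAddP

/-- The phase `exp(i c x̂ₖ²/2)` on mode `k`; it satisfies
`exp(-i c x̂²/2) p̂ exp(i c x̂²/2) = p̂ + c x̂`. -/
def chirp {M : ℕ} (k : Fin M) (c : ℝ) (φ : Wave M) : Wave M :=
  phase (fun x => c * x k ^ 2 / 2) (by fun_prop) φ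

/-- The position density of a vector, as a measure. -/
def bornMeasure {M : ℕ} (φ : Wave M) : Measure (Config M) :=
  volume.withDensity fun x => ENNReal.ofReal (‖φ x‖ ^ 2)

/-- The law of the outcome when the quadrature `q` of mode `k` is measured in the vector `φ`
(`ħ = 1`; the momentum is `2π` times the frequency of the Fourier transform
`∫ exp(-2πi⟨x, ξ⟩) φ(x) dx`). -/
def vecHomodyne {M : ℕ} (q : Quadrature) (k : Fin M) (φ : Wave M) : Measure ℝ :=
  match q with
  | .x => (bornMeasure φ).map fun x => x k
  | .p => (bornMeasure (𝓕 φ)).map fun ξ => 2 * Real.pi * ξ k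
  | .xSubP => (bornMeasure (𝓕 (chirp k (-1) φ))).map fun ξ => -(2 * Real.pi * ξ k)
  | .xAddP => (bornMeasure (𝓕 (chirp k 1 φ))).map fun ξ => 2 * Real.pi * ξ k

/-- The law of the outcome when the quadrature `q` of mode `k` is measured in the state `ρ`. -/
def homodyne {M : ℕ} (ρ : DensityOperator (Wave M)) (q : Quadrature) (k : Fin M) : Measure ℝ :=
  Measure.sum fun i => vecHomodyne q k (ρ.vec i)

/-! ### The ideal resource state -/

/-- The wavefunction of the product of `M` finitely squeezed cubic phase states,
`∏ₖ exp(i γ xₖ³) exp(-xₖ²/(2s²)) / (√s π^{1/4})`. -/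
def cubicFun (s γ : ℝ) (M : ℕ) (x : Config M) : ℂ :=
  ∏ k, Complex.exp (Complex.I * γ * (x k : ℂ) ^ 3) * Complex.exp (-(x k : ℂ) ^ 2 / (2 * s ^ 2)) /
    ((Real.sqrt s * Real.pi ^ (1 / 4 : ℝ) : ℝ) : ℂ)

lemma memLp_cubicFun {s : ℝ} (hs : 0 < s) (γ : ℝ) (M : ℕ) :
    MemLp (cubicFun s γ M) 2 volume := by
  have hm : AEStronglyMeasurable (cubicFun s γ M) volume := by
    refine Continuous.aestronglyMeasurable ?_
    unfold cubicFun
    fun_prop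
  rw [memLp_two_iff_integrable_sq_norm hm]
  have hb : 0 < ((1 / s ^ 2 : ℝ) : ℂ).re := by
    rw [Complex.ofReal_re]; positivity
  have hg := (GaussianFourier.integrable_cexp_neg_mul_sq_norm_add (V := Config M) hb 0 0).norm
  refine (hg.const_mul ((∏ _k : Fin M, (Real.sqrt s * Real.pi ^ (1 / 4 : ℝ))⁻¹) ^ 2)).congr
    (Filter.Eventually.of_forall fun x => ?_)
  have hnorm : ∀ k : Fin M, ‖Complex.exp (Complex.I * γ * (x k : ℂ) ^ 3) *
      Complex.exp (-(x k : ℂ) ^ 2 / (2 * s ^ 2)) /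
      ((Real.sqrt s * Real.pi ^ (1 / 4 : ℝ) : ℝ) : ℂ)‖ =
      Real.exp (-(x k) ^ 2 / (2 * s ^ 2)) * (Real.sqrt s * Real.pi ^ (1 / 4 : ℝ))⁻¹ := by
    intro k
    have h1 : Complex.I * γ * (x k : ℂ) ^ 3 = ((γ * x k ^ 3 : ℝ) : ℂ) * Complex.I := by
      push_cast; ring
    have h2 : -(x k : ℂ) ^ 2 / (2 * s ^ 2) = ((-(x k) ^ 2 / (2 * s ^ 2) : ℝ) : ℂ) := by
      push_cast; ring
    have h3 : 0 ≤ Real.sqrt s * Real.pi ^ (1 / 4 : ℝ) := by positivity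
    rw [norm_div, norm_mul, h1, h2, Complex.norm_exp_ofReal_mul_I, one_mul, Complex.norm_exp,
      Complex.ofReal_re, Complex.norm_of_nonneg h3, div_eq_mul_inv]
  have hexp : ‖Complex.exp (-((1 / s ^ 2 : ℝ) : ℂ) * (‖x‖ : ℂ) ^ 2 +
      0 * ((⟪(0 : Config M), x⟫_ℝ : ℝ) : ℂ))‖ =
      (∏ k : Fin M, Real.exp (-(x k) ^ 2 / (2 * s ^ 2))) ^ 2 := by
    have h : -((1 / s ^ 2 : ℝ) : ℂ) * (‖x‖ : ℂ) ^ 2 + 0 * ((⟪(0 : Config M), x⟫_ℝ : ℝ) : ℂ) =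
        ((-(1 / s ^ 2) * ‖x‖ ^ 2 : ℝ) : ℂ) := by
      push_cast; ring
    rw [h, Complex.norm_exp, Complex.ofReal_re, ← Real.exp_sum, ← Real.exp_nat_mul,
      EuclideanSpace.norm_sq_eq]
    congr 1
    rw [Finset.mul_sum, Finset.mul_sum]
    refine Finset.sum_congr rfl fun k _ => ?_
    rw [Real.norm_eq_abs, sq_abs]
    push_cast
    field_simp
  simp only [cubicFun]
  rw [hexp, norm_prod, Finset.prod_congr rfl fun k _ => hnorm k, Finset.prod_mul_distrib]
  ring

/-- The ideal `M`-mode resource vector; its projector is the target state `σ`. -/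
def cubic (s : ℝ) (hs : 0 < s) (γ : ℝ) (M : ℕ) : Wave M := (memLp_cubicFun hs γ M).toLp _

/-! ### The fidelity witness and the verification test -/

/-- The six single-mode observables `x̂²`, `x̂⁴`, `p̂²`, `p̂³`, `(x̂ - p̂)³`, `(x̂ + p̂)³` of the
witness: the quadrature, -/
def quad : Fin 6 → Quadrature :=
  ![.x, .x, .p, .p, .xSubP, .xAddP]

/-- the power of it, -/
def deg : Fin 6 → ℕ :=
  ![2, 4, 2, 3, 3, 3]

/-- and the coefficient `λ` in the witness
`W = (1 + M/2) 1 + ∑ₖ ∑ₐ λₐ fₐ⁽ᵏ⁾`. Here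
`∑ₐ λₐ fₐ = -(x̂²/(2s²) + (s²/2)(p̂ - 3γx̂²)²) = -(V n̂ V† + 1/2)`,
where `V n̂ V†` is the number operator transported to the cubic phase state. -/
def coeff (s γ : ℝ) : Fin 6 → ℝ :=
  ![-(1 / (2 * s ^ 2)), -(9 * γ ^ 2 * s ^ 2 / 2), -(s ^ 2 / 2), -(γ * s ^ 2),
    -(γ * s ^ 2 / 2), γ * s ^ 2 / 2]

/-- `∑ |λ|` over all modes and observables. -/
def totalWeight (s γ : ℝ) (M : ℕ) : ℝ := ∑ _k : Fin M, ∑ a, |coeff s γ a|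

/-- `F_low = Tr(W ρ)`. -/
def witnessValue (s γ : ℝ) {M : ℕ} (ρ : DensityOperator (Wave M)) : ℝ :=
  1 + (M : ℝ) / 2 + ∑ k : Fin M, ∑ a, coeff s γ a * ∫ v, v ^ deg a ∂(homodyne ρ (quad a) k)

/-- The record of one test measurement: the mode and the observable that were drawn, and the
measured value of the quadrature. -/
abbrev Trial (M : ℕ) := (Fin M × Fin 6) × ℝ

/-- Importance sampling on one copy of `ρ`: draw the observable with probability proportional to
the modulus of its coefficient, then measure its quadrature. -/
def trialLaw (s γ : ℝ) {M : ℕ} (ρ : DensityOperator (Wave M)) : Measure (Trial M) :=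
  ∑ a : Fin M × Fin 6, ENNReal.ofReal (|coeff s γ a.2| / totalWeight s γ M) •
    (homodyne ρ (quad a.2) a.1).map fun v => (a, v)

/-- The law of the test records of `N` independent copies of `ρ`. -/
def testLaw (s γ : ℝ) {M : ℕ} (N : ℕ) (ρ : DensityOperator (Wave M)) :
    Measure (Fin N → Trial M) :=
  Measure.pi fun _ => trialLaw s γ ρ

/-- The estimate `F_low^(est)`: the constant `1 + M/2` plus the sample mean of
`(∑ |λ|) sign(λ) f`, where `f` is the measured value of the drawn observable. -/
def estimate (s γ : ℝ) {M N : ℕ} (t : Fin N → Trial M) : ℝ :=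
  1 + (M : ℝ) / 2 + (1 / (N : ℝ)) * ∑ j, totalWeight s γ M * SignType.sign (coeff s γ (t j).1.2) *
    (t j).2 ^ deg (t j).1.2

/-- Alice accepts. -/
def Accepts (s γ F_T η : ℝ) {M N : ℕ} (t : Fin N → Trial M) : Prop :=
  F_T + η ≤ estimate s γ t

/-- Finite energy per mode: the second moments `Tr(f² ρ)` of the measured local observables `f`
are at most `E` in every mode. -/
def FiniteEnergy (E : ℝ) {M : ℕ} (ρ : DensityOperator (Wave M)) : Prop :=
  ∀ (k : Fin M) (a : Fin 6),
    ∫⁻ v, ENNReal.ofReal ((v ^ deg a) ^ 2) ∂(homodyne ρ (quad a) k) ≤ ENNReal.ofReal E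

/-- On every state of energy at most `E` per mode, the test with `N` copies estimates `F_low` to
precision `η` with failure probability at most `β`. -/
def TestAccurate (s γ E η β : ℝ) (M N : ℕ) : Prop :=
  ∀ ρ : DensityOperator (Wave M), FiniteEnergy E ρ →
    ENNReal.ofReal (1 - β) ≤ testLaw s γ N ρ {t | |estimate s γ t - witnessValue s γ ρ| < η}

/-! ### Alice's computation -/

/-- The scaling `y_k ↦ y_k / r` of one coordinate of the register. -/
def scaleEquiv {m M : ℕ} (k : Fin m) (r : ℝˣ) :
    (Config m × Config M) ≃ₗ[ℝ] (Config m × Config M) where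
  toFun z := (z.1 + (((r⁻¹ : ℝˣ) : ℝ) * z.1 k - z.1 k) • EuclideanSpace.single k (1 : ℝ), z.2)
  invFun z := (z.1 + ((r : ℝ) * z.1 k - z.1 k) • EuclideanSpace.single k (1 : ℝ), z.2)
  map_add' z w := by
    ext l
    · by_cases h : l = k <;> (simp [h]; try ring)
    · simp
  map_smul' c z := by
    ext l
    · by_cases h : l = k <;> (simp [h]; try ring)
    · simp
  left_inv z := by
    ext l
    · by_cases h : l = k
      · subst h; simp
      · simp [h]
    · simp
  right_inv z := by
    ext l
    · by_cases h : l = k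
      · subst h; simp
      · simp [h]
    · simp

/-- The squeezing `S(r)` of register mode `k`: `(S(r) f)(y) = |r|^{-1/2} f(…, y_k / r, …)`, so that
`S(r)† x̂ S(r) = r x̂` and `S(r)† = S(r⁻¹)`. -/
def squeeze {m M : ℕ} (k : Fin m) (r : ℝˣ) (Φ : Joint m M) : Joint m M :=
  substitute (scaleEquiv k r) Φ

/-- The shear `x_j ↦ x_j + y_k`. -/
def shearEquiv {m M : ℕ} (k : Fin m) (j : Fin M) :
    (Config m × Config M) ≃ₗ[ℝ] (Config m × Config M) where
  toFun z := (z.1, z.2 + z.1 k • EuclideanSpace.single j (1 : ℝ))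
  invFun z := (z.1, z.2 - z.1 k • EuclideanSpace.single j (1 : ℝ))
  map_add' z w := by
    ext l
    · simp
    · by_cases h : l = j <;> (simp [h]; try ring)
  map_smul' c z := by
    ext l
    · simp
    · by_cases h : l = j <;> (simp [h]; try ring)
  left_inv z := by ext l <;> simp
  right_inv z := by ext l <;> simp

/-- The entangling gate `exp(i x̂_k ⊗ p̂_j)` between register mode `k` and resource mode `j`:
`Φ(y, x) ↦ Φ(y, x + y_k e_j)`. -/
def sumGate {m M : ℕ} (k : Fin m) (j : Fin M) (Φ : Joint m M) : Joint m M :=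
  substitute (shearEquiv k j) Φ

/-- The Gaussian correction `G⁻¹(x_meas) = exp(-iγ x_meas³) exp(-3iγ x_meas ŷ_k (ŷ_k + x_meas))`,
controlled by the value `x_meas = x_j` of the measured resource mode. -/
def correction {m M : ℕ} (γ : ℝ) (k : Fin m) (j : Fin M) (Φ : Joint m M) : Joint m M :=
  phase (fun z => -(γ * z.2 j ^ 3) - 3 * γ * z.2 j * z.1 k * (z.1 k + z.2 j)) (by fun_prop) Φ

/-- Teleportation of the cubic phase gate of strength `r³γ` to register mode `k` with the resource
mode `j`. The measurement of `x̂_j` is read out at the end, in `Circuit.verdictLaw`: all later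
operations commute with `x̂_j`. -/
def teleport {m M : ℕ} (γ : ℝ) (r : ℝˣ) (k : Fin m) (j : Fin M) (Φ : Joint m M) : Joint m M :=
  squeeze k r⁻¹ (correction γ k j (sumGate k j (squeeze k r Φ)))

/-- A unitary of the register and the resource modes that is of the form `V ⊗ 1`, where `V` is a
unitary of the register. -/
def IsRegisterGate {m M : ℕ} (U : Joint m M ≃ₗᵢ[ℂ] Joint m M) : Prop :=
  ∃ V : Wave m ≃ₗᵢ[ℂ] Wave m, ∀ (ψ : Wave m) (φ : Wave M), U (tensor ψ φ) = tensor (V ψ) φ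

/-- Alice's computation: a pure input state of `m` modes, and `M` cubic phase gates interleaved
with unitary gates of the `m` modes. Gate number `j` acts before the `j`-th cubic phase gate and
gate number `M` at the end; the `j`-th cubic phase gate has strength `(r j)³γ` and acts on mode
`mode j`. (Alice's input and gates are Gaussian in the protocol; any others are allowed here.) -/
structure Circuit (m M : ℕ) where
  /-- input state -/
  input : Wave m
  norm_input : ‖input‖ = 1
  /-- Alice's own gates -/
  gate : Fin (M + 1) → (Joint m M ≃ₗᵢ[ℂ] Joint m M)
  isRegisterGate : ∀ j, IsRegisterGate (gate j)
  /-- the mode on which the cubic phase gate acts -/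
  mode : Fin M → Fin m
  /-- Alice's private squeezing parameter -/
  r : Fin M → ℝˣ

namespace Circuit

variable {m M : ℕ} (A : Circuit m M)

/-- The joint vector before the measured values of the resource modes are read out, when the
resource is in the pure state `φ`. -/
def run (γ : ℝ) (φ : Wave M) : Joint m M :=
  A.gate (Fin.last M) ((List.finRange M).foldl
    (fun Φ j => teleport γ (A.r j) (A.mode j) j (A.gate j.castSucc Φ)) (tensor A.input φ))

/-- The ideal (unnormalized) output `Ψ_out` for the measured values `x`. -/
def idealOutput (s : ℝ) (hs : 0 < s) (γ : ℝ) (x : Config M) : Config m → ℂ :=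
  fun y => A.run γ (cubic s hs γ M) (y, x)

/-- The component along the ideal output, `P_correct`, of the output for the measured
values `x`. -/
def correctPart (s : ℝ) (hs : 0 < s) (γ : ℝ) (φ : Wave M) (x : Config M) : Config m → ℂ :=
  fun y => (∫ y', star (A.idealOutput s hs γ x y') * A.run γ φ (y', x)) /
    (∫ y', ‖A.idealOutput s hs γ x y'‖ ^ 2 : ℝ) * A.idealOutput s hs γ x y

/-- The component `P_incorrect = 1 - P_correct` of the output for the measured values `x`. -/
def incorrectPart (s : ℝ) (hs : 0 < s) (γ : ℝ) (φ : Wave M) (x : Config M) : Config m → ℂ :=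
  fun y => A.run γ φ (y, x) - A.correctPart s hs γ φ x y

/-- The joint law of the measured values of the resource modes and of the verdict of the
projective measurement `{P_correct, P_incorrect}` on the output (`true` for correct), when the
computation consumes the state `ρ`. -/
def verdictLaw (s : ℝ) (hs : 0 < s) (γ : ℝ) (ρ : DensityOperator (Wave M)) :
    Measure (Config M × Bool) :=
  Measure.sum fun i =>
    (volume.withDensity fun x =>
      ∫⁻ y, ENNReal.ofReal (‖A.correctPart s hs γ (ρ.vec i) x y‖ ^ 2)).map (fun x => (x, true)) +
    (volume.withDensity fun x =>
      ∫⁻ y, ENNReal.ofReal (‖A.incorrectPart s hs γ (ρ.vec i) x y‖ ^ 2)).map (fun x => (x, false))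

/-- The law of a whole run on `N + 1` independent copies of `ρ`: the records of the `N` test
copies, and the computation with the remaining copy. -/
def runLaw (s : ℝ) (hs : 0 < s) (γ : ℝ) (N : ℕ) (ρ : DensityOperator (Wave M)) :
    Measure ((Fin N → Trial M) × (Config M × Bool)) :=
  (testLaw s γ N ρ).prod (A.verdictLaw s hs γ ρ)

/-- The assisted computation is `ε`-verifiable against a server who prepares independent identical
copies of a state of energy at most `E` per mode: the joint probability that Alice accepts and
that the output is incorrect is at most `ε`. -/
def IsVerifiable (s : ℝ) (hs : 0 < s) (γ F_T η : ℝ) (N : ℕ) (E ε : ℝ) : Prop :=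
  0 ≤ ε ∧ ε ≤ 1 ∧ ∀ ρ : DensityOperator (Wave M), FiniteEnergy E ρ →
    A.runLaw s hs γ N ρ {z | Accepts s γ F_T η z.1 ∧ z.2.2 = false} ≤ ENNReal.ofReal ε

end Circuit

end CVVerify

end

/-!
The cubic phase gate and a squeezing carry the vacuum to the cubic phase state and the annihilation
operators to differential operators `Bₖ` that kill it. The witness is `1` minus the transported
number operator `∑ₖ Bₖ† Bₖ`, which vanishes on the cubic phase state and is at least `1` on its
orthogonal complement. So `Tr(W ρ)` bounds from below the fidelity of `ρ` with the ideal resource.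
As `ρ` is only known through its homodyne moments, the gap is derived by duality: `⟪φ, Bₖ χ⟫` is
computed on displaced cubic phase states `χ`, which are total because their overlaps with a vector
form a Fourier transform.

The teleportation circuit acts on the resource as an isometry, so an incorrect output is at most as
probable as the infidelity `1 - F` of the resource. The sampled estimate is unbiased with variance
`O(M² / N)`. Write `w = Tr(W ρ) ≤ F`. If `w ≥ F_T`, an incorrect output is rare. If `w < F_T`,
either the assumed accuracy makes acceptance rare, or Chebyshev's inequality bounds its probability
by `v / (F_T + η - w)²` with `v` the variance; times `1 - w` this is at most `1 - F_T`.
-/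

noncomputable section

namespace CVVerify

open scoped ContDiff

/-! ### Isometries between spaces of square-integrable functions -/

section LTwo

variable {X Y : Type*} [MeasurableSpace X] [MeasurableSpace Y] {μ : Measure X} {ν : Measure Y}

lemma inner_eq_integral_of_ae_eq {u v : Lp ℂ 2 μ} {f g : X → ℂ} (hu : u =ᵐ[μ] f)
    (hv : v =ᵐ[μ] g) : ⟪u, v⟫_ℂ = ∫ x, star (f x) * g x ∂μ := by
  rw [L2.inner_def]
  refine integral_congr_ae ?_
  filter_upwards [hu, hv] with x hx hx'
  rw [hx, hx', RCLike.inner_apply, mul_comm, RCLike.star_def]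

lemma integrable_norm_sq (u : Lp ℂ 2 μ) : Integrable (fun x => ‖u x‖ ^ 2) μ :=
  (memLp_two_iff_integrable_sq_norm (Lp.memLp u).1).1 (Lp.memLp u)

lemma norm_sq_eq_integral_of_ae_eq {u : Lp ℂ 2 μ} {f : X → ℂ} (hu : u =ᵐ[μ] f) :
    ‖u‖ ^ 2 = ∫ x, ‖f x‖ ^ 2 ∂μ := by
  have h : ((‖u‖ ^ 2 : ℝ) : ℂ) = ((∫ x, ‖f x‖ ^ 2 ∂μ : ℝ) : ℂ) := by
    rw [← integral_complex_ofReal, Complex.ofReal_pow]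
    refine (inner_self_eq_norm_sq_to_K u).symm.trans ?_
    simp only [inner_eq_integral_of_ae_eq hu hu, Complex.star_def, Complex.conj_mul',
      Complex.ofReal_pow]
  exact Complex.ofReal_injective h

lemma lintegral_norm_sq_of_ae_eq {u : Lp ℂ 2 μ} {f : X → ℂ} (hu : u =ᵐ[μ] f) :
    ∫⁻ x, ENNReal.ofReal (‖f x‖ ^ 2) ∂μ = ENNReal.ofReal (‖u‖ ^ 2) := by
  have hf : Integrable (fun x => ‖f x‖ ^ 2) μ :=
    (integrable_norm_sq u).congr <| hu.fun_comp fun z => ‖z‖ ^ 2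
  rw [norm_sq_eq_integral_of_ae_eq hu, ofReal_integral_eq_lintegral_ofReal hf
    (Filter.Eventually.of_forall fun x => by positivity)]

/-- The linear isometry of `L²` spaces that acts by `f ↦ w · (f ∘ T)` almost everywhere, for a
map `F` that is already known to preserve norms. -/
def weightedCompₗᵢ {w : X → ℂ} {T : X → Y} (F : Lp ℂ 2 ν → Lp ℂ 2 μ)
    (hT : Measure.QuasiMeasurePreserving T μ ν) (hF : ∀ f, F f =ᵐ[μ] fun x => w x * f (T x))
    (hnorm : ∀ f, ‖F f‖ = ‖f‖) : Lp ℂ 2 ν →ₗᵢ[ℂ] Lp ℂ 2 μ where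
  toFun := F
  map_add' f g := by
    refine Lp.ext ?_
    filter_upwards [hF (f + g), hF f, hF g, hT.ae (Lp.coeFn_add f g), Lp.coeFn_add (F f) (F g)]
      with x hfg hf hg hadd hadd'
    rw [hfg, hadd', Pi.add_apply, hf, hg, hadd, Pi.add_apply, mul_add]
  map_smul' c f := by
    refine Lp.ext ?_
    filter_upwards [hF (c • f), hF f, hT.ae (Lp.coeFn_smul c f), Lp.coeFn_smul c (F f)]
      with x hcf hf hsmul hsmul'
    rw [RingHom.id_apply, hcf, hsmul', Pi.smul_apply, hf, hsmul, Pi.smul_apply, smul_eq_mul,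
      smul_eq_mul, mul_left_comm]
  norm_map' := hnorm

lemma coeFn_phase {θ : X → ℝ} (hθ : Measurable θ) (f : Lp ℂ 2 μ) :
    phase θ hθ f =ᵐ[μ] fun x => Complex.exp (Complex.I * θ x) * f x :=
  (memLp_phase hθ f).coeFn_toLp

lemma norm_phase {θ : X → ℝ} (hθ : Measurable θ) (f : Lp ℂ 2 μ) : ‖phase θ hθ f‖ = ‖f‖ := by
  rw [Lp.norm_def, Lp.norm_def]
  congr 1
  refine eLpNorm_congr_norm_ae ?_
  filter_upwards [coeFn_phase hθ f] with x hx
  rw [hx, norm_mul, mul_comm Complex.I, Complex.norm_exp_ofReal_mul_I, one_mul]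

/-- Multiplication by a phase as a linear isometry. -/
def phaseₗᵢ (θ : X → ℝ) (hθ : Measurable θ) : Lp ℂ 2 μ →ₗᵢ[ℂ] Lp ℂ 2 μ :=
  weightedCompₗᵢ (phase θ hθ) (.id μ) (coeFn_phase hθ) (norm_phase hθ)

end LTwo

section Substitution

variable {X : Type*} [NormedAddCommGroup X] [NormedSpace ℝ X] [FiniteDimensional ℝ X]
  [MeasurableSpace X] [BorelSpace X] {μ : Measure X} [μ.IsAddHaarMeasure]

lemma measurePreserving_linearEquiv (T : X ≃ₗ[ℝ] X) : MeasurePreserving T μ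
    (ENNReal.ofReal |(LinearMap.det (T : X →ₗ[ℝ] X))⁻¹| • μ) :=
  ⟨T.toContinuousLinearEquiv.continuous.measurable,
    Measure.map_linearMap_addHaar_eq_smul_addHaar μ T.isUnit_det'.ne_zero⟩

lemma quasiMeasurePreserving_linearEquiv (T : X ≃ₗ[ℝ] X) :
    Measure.QuasiMeasurePreserving T μ μ :=
  ⟨(measurePreserving_linearEquiv (μ := μ) T).measurable,
    (measurePreserving_linearEquiv (μ := μ) T).map_eq ▸ Measure.smul_absolutelyContinuous⟩

lemma coeFn_substitute (T : X ≃ₗ[ℝ] X) (f : Lp ℂ 2 μ) : substitute T f =ᵐ[μ] fun x =>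
    (Real.sqrt |LinearMap.det (T : X →ₗ[ℝ] X)| : ℂ) * f (T x) :=
  (memLp_substitute T f).coeFn_toLp

lemma norm_substitute (T : X ≃ₗ[ℝ] X) (f : Lp ℂ 2 μ) : ‖substitute T f‖ = ‖f‖ := by
  have hdet : LinearMap.det (T : X →ₗ[ℝ] X) ≠ 0 := T.isUnit_det'.ne_zero
  rw [← sq_eq_sq₀ (norm_nonneg _) (norm_nonneg _),
    norm_sq_eq_integral_of_ae_eq (coeFn_substitute T f)]
  calc ∫ x, ‖(Real.sqrt |LinearMap.det (T : X →ₗ[ℝ] X)| : ℂ) * f (T x)‖ ^ 2 ∂μ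
      = |LinearMap.det (T : X →ₗ[ℝ] X)| * ∫ x, ‖f (T x)‖ ^ 2 ∂μ := by
        rw [← integral_const_mul]
        refine integral_congr_ae (Filter.Eventually.of_forall fun x => ?_)
        simp only [norm_mul, mul_pow, Complex.norm_real, Real.norm_eq_abs, sq_abs,
          Real.sq_sqrt (abs_nonneg _)]
    _ = |LinearMap.det (T : X →ₗ[ℝ] X)| *
          (|(LinearMap.det (T : X →ₗ[ℝ] X))⁻¹| * ∫ x, ‖f x‖ ^ 2 ∂μ) := by
        rw [(measurePreserving_linearEquiv T).integral_comp
          T.toContinuousLinearEquiv.toHomeomorph.measurableEmbedding fun x => ‖f x‖ ^ 2,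
          integral_smul_measure, ENNReal.toReal_ofReal (abs_nonneg _), smul_eq_mul]
    _ = ‖f‖ ^ 2 := by
        rw [← mul_assoc, ← abs_mul, mul_inv_cancel₀ hdet, abs_one, one_mul,
          ← norm_sq_eq_integral_of_ae_eq .rfl]

/-- The unitary change of variables of a linear automorphism as a linear isometry. -/
def substituteₗᵢ (T : X ≃ₗ[ℝ] X) : Lp ℂ 2 μ →ₗᵢ[ℂ] Lp ℂ 2 μ :=
  weightedCompₗᵢ (substitute T) (quasiMeasurePreserving_linearEquiv T) (coeFn_substitute T)
    (norm_substitute T)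

end Substitution

lemma coeFn_tensor {m M : ℕ} (ψ : Wave m) (φ : Wave M) :
    tensor ψ φ =ᵐ[volume] fun z => ψ z.1 * φ z.2 :=
  (memLp_tensor ψ φ).coeFn_toLp

lemma norm_tensor {m M : ℕ} (ψ : Wave m) (φ : Wave M) : ‖tensor ψ φ‖ = ‖ψ‖ * ‖φ‖ := by
  rw [← sq_eq_sq₀ (norm_nonneg _) (by positivity), mul_pow,
    norm_sq_eq_integral_of_ae_eq (coeFn_tensor ψ φ),
    norm_sq_eq_integral_of_ae_eq (u := ψ) .rfl,
    norm_sq_eq_integral_of_ae_eq (u := φ) .rfl]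
  simp only [norm_mul, mul_pow]
  exact integral_prod_mul (fun y => ‖ψ y‖ ^ 2) fun x => ‖φ x‖ ^ 2

/-- Tensoring with a unit vector of the register, as a linear isometry of the resource space. -/
def tensorₗᵢ {m M : ℕ} (ψ : Wave m) (hψ : ‖ψ‖ = 1) : Wave M →ₗᵢ[ℂ] Joint m M :=
  weightedCompₗᵢ (tensor ψ) Measure.quasiMeasurePreserving_snd (coeFn_tensor ψ)
    fun φ => by rw [norm_tensor, hψ, one_mul]

/-- Teleportation of a cubic phase gate as a linear isometry. -/
def teleportₗᵢ {m M : ℕ} (γ : ℝ) (r : ℝˣ) (k : Fin m) (j : Fin M) :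
    Joint m M →ₗᵢ[ℂ] Joint m M :=
  (substituteₗᵢ (scaleEquiv k r⁻¹)).comp <|
    (phaseₗᵢ (fun z => -(γ * z.2 j ^ 3) - 3 * γ * z.2 j * z.1 k * (z.1 k + z.2 j))
      (by fun_prop)).comp <|
    (substituteₗᵢ (shearEquiv k j)).comp (substituteₗᵢ (scaleEquiv k r))

/-- The computation as a linear isometry from the resource space to the joint space. -/
def Circuit.runₗᵢ {m M : ℕ} (A : Circuit m M) (γ : ℝ) : Wave M →ₗᵢ[ℂ] Joint m M :=
  (A.gate (Fin.last M)).toLinearIsometry.comp <|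
    (List.finRange M).foldl (fun L j => (teleportₗᵢ γ (A.r j) (A.mode j) j).comp
      ((A.gate j.castSucc).toLinearIsometry.comp L)) (tensorₗᵢ A.input A.norm_input)

lemma Circuit.runₗᵢ_apply {m M : ℕ} (A : Circuit m M) (γ : ℝ) (φ : Wave M) :
    A.runₗᵢ γ φ = A.run γ φ :=
  congrArg (A.gate (Fin.last M))
    (List.foldl_hom (fun L : Wave M →ₗᵢ[ℂ] Joint m M => L φ) fun _ _ => rfl).symm

/-! ### The probability of an incorrect output -/

section Projection

lemma norm_sub_inner_smul_sq {H : Type*} [NormedAddCommGroup H] [InnerProductSpace ℂ H]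
    {e : H} (he : ‖e‖ = 1) (f : H) :
    ‖f - ⟪e, f⟫_ℂ • e‖ ^ 2 = ‖f‖ ^ 2 - ‖⟪e, f⟫_ℂ‖ ^ 2 := by
  have horth : ⟪⟪e, f⟫_ℂ • e, f - ⟪e, f⟫_ℂ • e⟫_ℂ = 0 := by
    rw [inner_smul_left, inner_sub_right, inner_smul_right, inner_self_eq_norm_sq_to_K, he]
    simp
  have hpyth := norm_add_sq_eq_norm_sq_add_norm_sq_of_inner_eq_zero (𝕜 := ℂ) _ _ horth
  rw [add_sub_cancel, norm_smul, he] at hpyth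
  linarith

lemma norm_sub_inner_div_smul_le {H : Type*} [NormedAddCommGroup H] [InnerProductSpace ℂ H]
    (f g : H) (c : ℂ) :
    ‖f - (⟪g, f⟫_ℂ / ((‖g‖ ^ 2 : ℝ) : ℂ)) • g‖ ≤ ‖f - c • g‖ := by
  have hproj : (Submodule.span ℂ {g}).starProjection f =
      (⟪g, f⟫_ℂ / ((‖g‖ ^ 2 : ℝ) : ℂ)) • g := Submodule.starProjection_singleton ℂ f
  rw [← hproj, Submodule.starProjection_minimal]
  exact ciInf_le ⟨0, by rintro _ ⟨x, rfl⟩; exact norm_nonneg _⟩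
    (⟨c • g, Submodule.smul_mem _ c (Submodule.mem_span_singleton_self g)⟩ : Submodule.span ℂ {g})

lemma lintegral_norm_sq_sub_projection_le {X : Type*} [MeasurableSpace X] {μ : Measure X}
    {f g : X → ℂ} (hf : MemLp f 2 μ) (hg : MemLp g 2 μ) (c : ℂ) :
    ∫⁻ x, ENNReal.ofReal (‖f x - (∫ x', star (g x') * f x' ∂μ) /
      ((∫ x', ‖g x'‖ ^ 2 ∂μ : ℝ) : ℂ) * g x‖ ^ 2) ∂μ ≤
      ∫⁻ x, ENNReal.ofReal (‖f x - c * g x‖ ^ 2) ∂μ := by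
  have hsub : ∀ a : ℂ, (hf.toLp f - a • hg.toLp g : Lp ℂ 2 μ) =ᵐ[μ] fun x => f x - a * g x := by
    intro a
    filter_upwards [Lp.coeFn_sub (hf.toLp f) (a • hg.toLp g), Lp.coeFn_smul a (hg.toLp g),
      hf.coeFn_toLp, hg.coeFn_toLp] with x hsub hsmul hfx hgx
    rw [hsub, Pi.sub_apply, hsmul, Pi.smul_apply, hfx, hgx, smul_eq_mul]
  rw [← inner_eq_integral_of_ae_eq hg.coeFn_toLp hf.coeFn_toLp,
    ← norm_sq_eq_integral_of_ae_eq hg.coeFn_toLp, lintegral_norm_sq_of_ae_eq (hsub _),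
    lintegral_norm_sq_of_ae_eq (hsub c)]
  gcongr
  exact norm_sub_inner_div_smul_le _ _ c

end Projection

section Slices

variable {X Y : Type*} [MeasurableSpace X] [MeasurableSpace Y] {μ : Measure X} {ν : Measure Y}
  [SFinite μ] [SFinite ν]

lemma ae_memLp_slice (Φ : Lp ℂ 2 (μ.prod ν)) : ∀ᵐ y ∂ν, MemLp (fun x => Φ (x, y)) 2 μ := by
  filter_upwards [(integrable_norm_sq Φ).prod_left_ae, (Lp.memLp Φ).1.prod_swap.prodMk_left]
    with y hint hmeas
  exact (memLp_two_iff_integrable_sq_norm hmeas).2 hint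

lemma lintegral_lintegral_norm_sq (Φ : Lp ℂ 2 (μ.prod ν)) :
    ∫⁻ y, ∫⁻ x, ENNReal.ofReal (‖Φ (x, y)‖ ^ 2) ∂μ ∂ν = ENNReal.ofReal (‖Φ‖ ^ 2) := by
  rw [← lintegral_norm_sq_of_ae_eq (u := Φ) .rfl]
  exact (lintegral_prod_symm _
    ((Lp.aestronglyMeasurable Φ).norm.pow 2).aemeasurable.ennreal_ofReal).symm

lemma ae_ae_slice_of_ae {p : X × Y → Prop} (h : ∀ᵐ z ∂μ.prod ν, p z) :
    ∀ᵐ y ∂ν, ∀ᵐ x ∂μ, p (x, y) :=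
  Measure.ae_ae_of_ae_prod
    ((Measure.measurePreserving_swap (μ := ν) (ν := μ)).quasiMeasurePreserving.ae h)

end Slices

lemma Circuit.lintegral_incorrectPart_le {m M : ℕ} (A : Circuit m M) {s : ℝ} (hs : 0 < s) (γ : ℝ)
    (hnorm : ‖cubic s hs γ M‖ = 1) (φ : Wave M) :
    ∫⁻ x, ∫⁻ y, ENNReal.ofReal (‖A.incorrectPart s hs γ φ x y‖ ^ 2) ≤
      ENNReal.ofReal (‖φ‖ ^ 2 - ‖⟪cubic s hs γ M, φ⟫_ℂ‖ ^ 2) := by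
  set Ψ := cubic s hs γ M
  set c := ⟪Ψ, φ⟫_ℂ
  have hdiff : A.runₗᵢ γ (φ - c • Ψ) =ᵐ[volume] fun z => A.run γ φ z - c * A.run γ Ψ z := by
    rw [map_sub, map_smul, A.runₗᵢ_apply, A.runₗᵢ_apply]
    filter_upwards [Lp.coeFn_sub (A.run γ φ) (c • A.run γ Ψ), Lp.coeFn_smul c (A.run γ Ψ)]
      with z hsub hsmul
    rw [hsub, Pi.sub_apply, hsmul, Pi.smul_apply, smul_eq_mul]
  rw [← norm_sub_inner_smul_sq hnorm φ, ← (A.runₗᵢ γ).norm_map]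
  refine le_of_le_of_eq ?_ (lintegral_lintegral_norm_sq (A.runₗᵢ γ (φ - c • Ψ)))
  refine lintegral_mono_ae ?_
  filter_upwards [ae_ae_slice_of_ae hdiff, ae_memLp_slice (A.run γ φ),
    ae_memLp_slice (A.run γ Ψ)] with x hx hφ hΨ
  exact (lintegral_norm_sq_sub_projection_le hφ hΨ c).trans_eq
    (lintegral_congr_ae (hx.mono fun y hy => by simp only [hy]))

/-! ### Weak directional derivatives -/

section FDeriv

variable {V : Type*} [NormedAddCommGroup V] [NormedSpace ℝ V]

lemma contDiff_fderiv_apply {g : V → ℂ} (hg : ContDiff ℝ ∞ g) (v : V) :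
    ContDiff ℝ ∞ fun x => fderiv ℝ g x v :=
  (hg.fderiv_right (m := ∞) le_rfl).clm_apply contDiff_const

lemma fderiv_mul_apply {f g : V → ℂ} {x : V} (hf : DifferentiableAt ℝ f x)
    (hg : DifferentiableAt ℝ g x) (v : V) :
    fderiv ℝ (fun x => f x * g x) x v = fderiv ℝ f x v * g x + f x * fderiv ℝ g x v := by
  rw [fderiv_fun_mul hf hg]
  simp only [add_apply, smul_apply, smul_eq_mul]
  ring

end FDeriv

section WeakDeriv

variable {V : Type*} [NormedAddCommGroup V] [InnerProductSpace ℝ V] [FiniteDimensional ℝ V]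
  [MeasurableSpace V] [BorelSpace V] {v : V}

/-- `u` is the weak (distributional) derivative of `f` in the direction `v`, tested against smooth
compactly supported complex functions. -/
structure HasWeakDeriv (v : V) (f u : V → ℂ) : Prop where
  locallyIntegrable : LocallyIntegrable f
  locallyIntegrable_deriv : LocallyIntegrable u
  integral_eq : ∀ g : V → ℂ, ContDiff ℝ ∞ g → HasCompactSupport g →
    ∫ x, fderiv ℝ g x v * f x = -∫ x, g x * u x

lemma integrable_mul_of_hasCompactSupport {f g : V → ℂ} (hg : Continuous g)
    (hg' : HasCompactSupport g) (hf : LocallyIntegrable f) : Integrable fun x => g x * f x :=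
  hf.integrable_smul_left_of_hasCompactSupport hg hg'

lemma locallyIntegrable_continuous_mul {f g : V → ℂ} (hg : Continuous g)
    (hf : LocallyIntegrable f) : LocallyIntegrable fun x => g x * f x :=
  locallyIntegrableOn_univ.1 <| (hf.locallyIntegrableOn Set.univ).continuousOn_smul
    isOpen_univ.isLocallyClosed hg.continuousOn

lemma locallyIntegrable_coeFn (φ : Lp ℂ 2 (volume : Measure V)) : LocallyIntegrable φ :=
  (Lp.memLp φ).locallyIntegrable (by norm_num)

namespace HasWeakDeriv

variable {f f' u u' : V → ℂ}

lemma of_contDiff (hf : ContDiff ℝ ∞ f) : HasWeakDeriv v f fun x => fderiv ℝ f x v where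
  locallyIntegrable := hf.continuous.locallyIntegrable
  locallyIntegrable_deriv := (contDiff_fderiv_apply hf v).continuous.locallyIntegrable
  integral_eq g hg hg' := by
    have hf' := (contDiff_fderiv_apply hf v).continuous.locallyIntegrable (μ := volume)
    have hg_fderiv := (contDiff_fderiv_apply hg v).continuous
    have hparts := integral_mul_fderiv_eq_neg_fderiv_mul_of_integrable
      (μ := (volume : Measure V)) (f := g) (g := f) (v := v)
      (integrable_mul_of_hasCompactSupport hg_fderiv (hg'.fderiv_apply ℝ v)
        hf.continuous.locallyIntegrable)
      (integrable_mul_of_hasCompactSupport hg.continuous hg' hf')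
      (integrable_mul_of_hasCompactSupport hg.continuous hg' hf.continuous.locallyIntegrable)
      (fun x _ => hg.differentiable (by simp) x) (fun x _ => hf.differentiable (by simp) x)
    rw [hparts, neg_neg]

lemma congr (h : HasWeakDeriv v f u) (hf : f =ᵐ[volume] f') (hu : u =ᵐ[volume] u') :
    HasWeakDeriv v f' u' where
  locallyIntegrable := h.locallyIntegrable.congr hf
  locallyIntegrable_deriv := h.locallyIntegrable_deriv.congr hu
  integral_eq g hg hg' := by
    rw [← integral_congr_ae (hf.mono fun x hx => congrArg (fderiv ℝ g x v * ·) hx),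
      h.integral_eq g hg hg', integral_congr_ae (hu.mono fun x hx => congrArg (g x * ·) hx)]

lemma add (h : HasWeakDeriv v f u) (h' : HasWeakDeriv v f' u') :
    HasWeakDeriv v (fun x => f x + f' x) (fun x => u x + u' x) where
  locallyIntegrable := h.locallyIntegrable.add h'.locallyIntegrable
  locallyIntegrable_deriv := h.locallyIntegrable_deriv.add h'.locallyIntegrable_deriv
  integral_eq g hg hg' := by
    have hc := (contDiff_fderiv_apply hg v).continuous
    have hs := hg'.fderiv_apply ℝ v
    simp only [mul_add]
    rw [integral_add (integrable_mul_of_hasCompactSupport hc hs h.locallyIntegrable)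
        (integrable_mul_of_hasCompactSupport hc hs h'.locallyIntegrable),
      integral_add (integrable_mul_of_hasCompactSupport hg.continuous hg' h.locallyIntegrable_deriv)
        (integrable_mul_of_hasCompactSupport hg.continuous hg' h'.locallyIntegrable_deriv),
      h.integral_eq g hg hg', h'.integral_eq g hg hg', neg_add]

lemma mul_left {a : V → ℂ} (h : HasWeakDeriv v f u) (ha : ContDiff ℝ ∞ a) :
    HasWeakDeriv v (fun x => a x * f x) (fun x => a x * u x + fderiv ℝ a x v * f x) where
  locallyIntegrable := locallyIntegrable_continuous_mul ha.continuous h.locallyIntegrable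
  locallyIntegrable_deriv :=
    (locallyIntegrable_continuous_mul ha.continuous h.locallyIntegrable_deriv).add
      (locallyIntegrable_continuous_mul (contDiff_fderiv_apply ha v).continuous
        h.locallyIntegrable)
  integral_eq g hg hg' := by
    have hga : ContDiff ℝ ∞ fun x => g x * a x := hg.mul ha
    have hga' : HasCompactSupport fun x => g x * a x := hg'.mul_right
    have hleibniz : ∀ x, fderiv ℝ g x v * (a x * f x) =
        fderiv ℝ (fun x => g x * a x) x v * f x - g x * (fderiv ℝ a x v * f x) := fun x => by
      rw [fderiv_mul_apply (hg.differentiable (by simp) x) (ha.differentiable (by simp) x)]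
      ring
    have hint : Integrable fun x => g x * (fderiv ℝ a x v * f x) :=
      integrable_mul_of_hasCompactSupport hg.continuous hg'
        (locallyIntegrable_continuous_mul (contDiff_fderiv_apply ha v).continuous
          h.locallyIntegrable)
    simp only [hleibniz, mul_add, ← mul_assoc (g _) (a _) (u _)]
    rw [integral_sub (integrable_mul_of_hasCompactSupport (contDiff_fderiv_apply hga v).continuous
        (hga'.fderiv_apply ℝ v) h.locallyIntegrable) hint,
      integral_add (integrable_mul_of_hasCompactSupport hga.continuous hga'
        h.locallyIntegrable_deriv) hint, h.integral_eq _ hga hga']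
    ring

lemma unique (h : HasWeakDeriv v f u) (h' : HasWeakDeriv v f u') : u =ᵐ[volume] u' := by
  refine ae_eq_of_integral_contDiff_smul_eq h.locallyIntegrable_deriv h'.locallyIntegrable_deriv
    fun g hg hg' => ?_
  have hgc : ContDiff ℝ ∞ fun x => (g x : ℂ) := Complex.ofRealCLM.contDiff.comp hg
  have hgc' : HasCompactSupport fun x => (g x : ℂ) := hg'.comp_left Complex.ofReal_zero
  simp only [Complex.real_smul]
  exact neg_injective ((h.integral_eq _ hgc hgc').symm.trans (h'.integral_eq _ hgc hgc'))

end HasWeakDeriv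

/-- The vector `ψ` is the derivative of `φ` in the direction `v` in the sense of the Fourier
transform on `L²`. -/
def HasFourierDeriv (v : V) (φ ψ : Lp ℂ 2 (volume : Measure V)) : Prop :=
  (𝓕 ψ : Lp ℂ 2 (volume : Measure V)) =ᵐ[volume] fun ξ =>
    2 * Real.pi * Complex.I * (⟪ξ, v⟫_ℝ : ℂ) * (𝓕 φ : Lp ℂ 2 (volume : Measure V)) ξ

namespace HasFourierDeriv

variable {φ φ' ψ ψ' : Lp ℂ 2 (volume : Measure V)}

lemma inner_eq_neg_inner (h : HasFourierDeriv v φ φ') (h' : HasFourierDeriv v ψ ψ') :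
    ⟪φ', ψ⟫_ℂ = -⟪φ, ψ'⟫_ℂ := by
  rw [← Lp.inner_fourier_eq, ← Lp.inner_fourier_eq φ,
    inner_eq_integral_of_ae_eq h (v := 𝓕 ψ) .rfl, inner_eq_integral_of_ae_eq (u := 𝓕 φ) .rfl h',
    ← integral_neg]
  refine integral_congr_ae (Filter.Eventually.of_forall fun ξ => ?_)
  simp only [star_mul', Complex.star_def, Complex.conj_I, Complex.conj_ofReal, map_ofNat]
  ring

lemma lineDeriv (G : SchwartzMap V ℂ) :
    HasFourierDeriv v (G.toLp 2) ((LineDeriv.lineDerivOp v G).toLp 2) := by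
  have htemperate : (inner ℝ · v : V → ℝ).HasTemperateGrowth :=
    ((innerSL ℝ).flip v).hasTemperateGrowth
  rw [HasFourierDeriv, SchwartzMap.toLp_fourier_eq, SchwartzMap.toLp_fourier_eq]
  filter_upwards [(𝓕 (LineDeriv.lineDerivOp v G)).coeFn_toLp 2 volume,
    (𝓕 G).coeFn_toLp 2 volume] with ξ hξ hξ'
  rw [hξ, hξ']
  simp only [SchwartzMap.fourier_lineDerivOp_eq, smul_apply,
    SchwartzMap.smulLeftCLM_apply_apply htemperate, smul_eq_mul, Complex.real_smul]
  ring

lemma hasWeakDeriv (h : HasFourierDeriv v φ ψ) : HasWeakDeriv v φ ψ where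
  locallyIntegrable := locallyIntegrable_coeFn φ
  locallyIntegrable_deriv := locallyIntegrable_coeFn ψ
  integral_eq g hg hg' := by
    have hstar : ContDiff ℝ ∞ fun x => star (g x) :=
      (Complex.conjCLE : ℂ ≃L[ℝ] ℂ).contDiff.comp hg
    have hstar' : HasCompactSupport fun x => star (g x) := hg'.comp_left (star_zero ℂ)
    set G := hstar'.toSchwartzMap hstar
    have hderiv : ∀ x, star (LineDeriv.lineDerivOp v G x) = fderiv ℝ g x v := fun x => by
      have hfderiv : HasFDerivAt G ((Complex.conjCLE : ℂ →L[ℝ] ℂ).comp (fderiv ℝ g x)) x :=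
        (Complex.conjCLE : ℂ →L[ℝ] ℂ).hasFDerivAt.comp x
          (hg.differentiable (by simp) x).hasFDerivAt
      rw [SchwartzMap.lineDerivOp_apply_eq_fderiv, hfderiv.fderiv]
      simp
    have hG := (lineDeriv (v := v) G).inner_eq_neg_inner h
    rw [inner_eq_integral_of_ae_eq ((LineDeriv.lineDerivOp v G).coeFn_toLp 2 volume)
        (v := φ) .rfl,
      inner_eq_integral_of_ae_eq (G.coeFn_toLp 2 volume) (v := ψ) .rfl] at hG
    simp only [hderiv] at hG
    exact hG.trans (congrArg Neg.neg (integral_congr_ae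
      (Filter.Eventually.of_forall fun x => congrArg (· * ψ x) (star_star (g x)))))

end HasFourierDeriv

end WeakDeriv

/-! ### Integration by parts against square-integrable functions -/

section Cutoff

variable {V : Type*} [NormedAddCommGroup V] [InnerProductSpace ℝ V] [FiniteDimensional ℝ V]

/-- A sequence of smooth cutoff functions, equal to `1` on the ball of radius `n + 1`, whose first
derivatives tend to `0` uniformly. -/
def cutoff (n : ℕ) (x : V) : ℂ :=
  ((⟨1, 2, one_pos, one_lt_two⟩ : ContDiffBump (0 : V)) (((n : ℝ) + 1)⁻¹ • x) : ℝ)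

lemma contDiff_cutoff (n : ℕ) : ContDiff ℝ ∞ (cutoff n : V → ℂ) :=
  Complex.ofRealCLM.contDiff.comp ((ContDiffBump.contDiff _).comp (contDiff_const_smul _))

lemma hasCompactSupport_cutoff (n : ℕ) : HasCompactSupport (cutoff n : V → ℂ) :=
  HasCompactSupport.comp_left
    ((ContDiffBump.hasCompactSupport _).comp_smul (by positivity)) Complex.ofReal_zero

lemma norm_cutoff_le_one (n : ℕ) (x : V) : ‖cutoff n x‖ ≤ 1 := by
  rw [cutoff, Complex.norm_real, Real.norm_of_nonneg (ContDiffBump.nonneg _)]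
  exact ContDiffBump.le_one _

lemma cutoff_eq_one {n : ℕ} {x : V} (hx : ‖x‖ ≤ n + 1) : cutoff n x = 1 := by
  rw [cutoff, ContDiffBump.one_of_mem_closedBall, Complex.ofReal_one]
  rw [mem_closedBall_zero_iff, norm_smul, norm_inv, Real.norm_of_nonneg (by positivity)]
  exact (inv_mul_le_iff₀ (by positivity)).2 (by simpa using hx)

lemma tendsto_cutoff (x : V) :
    Filter.Tendsto (fun n => cutoff n x) Filter.atTop (nhds 1) := by
  refine tendsto_const_nhds.congr' ?_
  filter_upwards [Filter.eventually_ge_atTop ⌈‖x‖⌉₊] with n hn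
  exact (cutoff_eq_one ((Nat.ceil_le.1 hn).trans (by linarith))).symm

lemma fderiv_cutoff_apply (n : ℕ) (x v : V) :
    fderiv ℝ (cutoff n) x v =
      (((n : ℝ) + 1)⁻¹ : ℝ) * fderiv ℝ (cutoff 0) (((n : ℝ) + 1)⁻¹ • x) v := by
  have hscale : (cutoff n : V → ℂ) = fun x => cutoff 0 (((n : ℝ) + 1)⁻¹ • x) := by
    funext x
    simp [cutoff]
  rw [hscale, fderiv_comp_smul, smul_apply, Complex.real_smul]

lemma exists_norm_fderiv_cutoff_le (v : V) :
    ∃ C, ∀ n x, ‖fderiv ℝ (cutoff n) x v‖ ≤ ((n : ℝ) + 1)⁻¹ * C := by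
  obtain ⟨C, hC⟩ := (contDiff_fderiv_apply (contDiff_cutoff 0)
    v).continuous.bounded_above_of_compact_support ((hasCompactSupport_cutoff 0).fderiv_apply ℝ v)
  refine ⟨C, fun n x => ?_⟩
  rw [fderiv_cutoff_apply, norm_mul, Complex.norm_real, Real.norm_of_nonneg (by positivity)]
  gcongr
  exact hC _

variable [MeasurableSpace V] [BorelSpace V] {f : V → ℂ}

lemma integrable_cutoff_mul (n : ℕ) (hf : Integrable f) : Integrable fun x => cutoff n x * f x :=
  hf.bdd_mul (contDiff_cutoff n).continuous.aestronglyMeasurable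
    (Filter.Eventually.of_forall (norm_cutoff_le_one n))

lemma integrable_fderiv_cutoff_mul (v : V) (n : ℕ) (hf : Integrable f) :
    Integrable fun x => fderiv ℝ (cutoff n) x v * f x := by
  obtain ⟨C, hC⟩ := exists_norm_fderiv_cutoff_le v
  exact hf.bdd_mul (contDiff_fderiv_apply (contDiff_cutoff n) v).continuous.aestronglyMeasurable
    (Filter.Eventually.of_forall (hC n))

lemma tendsto_integral_cutoff_mul (hf : Integrable f) :
    Filter.Tendsto (fun n => ∫ x, cutoff n x * f x) Filter.atTop (nhds (∫ x, f x)) := by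
  refine tendsto_integral_of_dominated_convergence (fun x => ‖f x‖)
    (fun n => (integrable_cutoff_mul n hf).1) hf.norm
    (fun n => Filter.Eventually.of_forall fun x => ?_)
    (Filter.Eventually.of_forall fun x => ?_)
  · rw [norm_mul]
    exact mul_le_of_le_one_left (norm_nonneg _) (norm_cutoff_le_one n x)
  · simpa using (tendsto_cutoff x).mul_const (f x)

lemma tendsto_integral_fderiv_cutoff_mul (v : V) (hf : Integrable f) :
    Filter.Tendsto (fun n => ∫ x, fderiv ℝ (cutoff n) x v * f x) Filter.atTop (nhds 0) := by
  obtain ⟨C, hC⟩ := exists_norm_fderiv_cutoff_le v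
  have hbound : ∀ n : ℕ, ‖∫ x, fderiv ℝ (cutoff n) x v * f x‖ ≤
      1 / ((n : ℝ) + 1) * (C * ∫ x, ‖f x‖) := fun n => by
    rw [one_div, ← mul_assoc, ← integral_const_mul]
    refine norm_integral_le_of_norm_le (hf.norm.const_mul _)
      (Filter.Eventually.of_forall fun x => ?_)
    rw [norm_mul]
    exact mul_le_mul_of_nonneg_right (hC n x) (norm_nonneg _)
  refine squeeze_zero_norm hbound ?_
  simpa using (tendsto_one_div_add_atTop_nhds_zero_nat (𝕜 := ℝ)).mul_const (C * ∫ x, ‖f x‖)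

lemma HasWeakDeriv.integral_eq_of_memLp {v : V} {f u g : V → ℂ}
    (h : HasWeakDeriv v f u) (hf : MemLp f 2) (hu : MemLp u 2) (hg : ContDiff ℝ ∞ g)
    (hg2 : MemLp g 2) (hg2' : MemLp (fun x => fderiv ℝ g x v) 2) :
    ∫ x, fderiv ℝ g x v * f x = -∫ x, g x * u x := by
  have hderiv_f : Integrable fun x => fderiv ℝ g x v * f x := hg2'.integrable_mul hf
  have hgf : Integrable fun x => g x * f x := hg2.integrable_mul hf
  have hgu : Integrable fun x => g x * u x := hg2.integrable_mul hu
  have hcut : ∀ n, ∫ x, cutoff n x * (fderiv ℝ g x v * f x) =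
      -(∫ x, cutoff n x * (g x * u x)) - ∫ x, fderiv ℝ (cutoff n) x v * (g x * f x) := fun n => by
    have hparts := h.integral_eq (fun x => cutoff n x * g x) ((contDiff_cutoff n).mul hg)
      (hasCompactSupport_cutoff n).mul_right
    have hleibniz : ∀ x, fderiv ℝ (fun x => cutoff n x * g x) x v * f x =
        cutoff n x * (fderiv ℝ g x v * f x) + fderiv ℝ (cutoff n) x v * (g x * f x) := fun x => by
      rw [fderiv_mul_apply ((contDiff_cutoff n).differentiable (by simp) x)
        (hg.differentiable (by simp) x)]
      ring
    simp only [hleibniz, mul_assoc (cutoff n _)] at hparts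
    rw [integral_add (integrable_cutoff_mul n hderiv_f) (integrable_fderiv_cutoff_mul v n hgf)]
      at hparts
    exact eq_sub_of_add_eq hparts
  have hlim := (tendsto_integral_cutoff_mul hgu).neg.sub (tendsto_integral_fderiv_cutoff_mul v hgf)
  rw [sub_zero] at hlim
  exact tendsto_nhds_unique (tendsto_integral_cutoff_mul hderiv_f)
    (hlim.congr fun n => (hcut n).symm)

end Cutoff

/-! ### Displaced cubic phase states -/

/-- The unit vector of mode `k` in configuration space; `∂ₖ` is the derivative along it. -/
abbrev axis {M : ℕ} (k : Fin M) : Config M := EuclideanSpace.single k 1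

lemma hasFDerivAt_comp_apply {M : ℕ} {q : ℝ → ℂ} {q' : ℂ} {x : Config M} (k : Fin M)
    (hq : HasDerivAt q q' (x k)) : HasFDerivAt (fun x : Config M => q (x k))
      ((ContinuousLinearMap.toSpanSingleton ℝ q').comp (EuclideanSpace.proj k)) x :=
  HasFDerivAt.comp (g := q) (f := fun x : Config M => x k) x hq.hasFDerivAt
    (EuclideanSpace.proj (𝕜 := ℝ) k).hasFDerivAt

lemma fderiv_comp_apply_axis {M : ℕ} {q : ℝ → ℂ} {q' : ℂ} {x : Config M} {k : Fin M}
    (hq : HasDerivAt q q' (x k)) : fderiv ℝ (fun x : Config M => q (x k)) x (axis k) = q' := by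
  rw [(hasFDerivAt_comp_apply k hq).fderiv]
  simp

lemma fderiv_sum_comp_apply_axis {M : ℕ} {q : ℝ → ℂ} {q' : Fin M → ℂ} {x : Config M}
    (hq : ∀ l, HasDerivAt q (q' l) (x l)) (k : Fin M) :
    fderiv ℝ (fun x : Config M => ∑ l, q (x l)) x (axis k) = q' k := by
  rw [(HasFDerivAt.fun_sum fun l _ => hasFDerivAt_comp_apply l (hq l)).fderiv]
  simp

lemma contDiff_apply_ofReal {M : ℕ} (k : Fin M) : ContDiff ℝ ∞ fun x : Config M => (x k : ℂ) :=
  Complex.ofRealCLM.contDiff.comp (EuclideanSpace.proj (𝕜 := ℝ) k).contDiff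

@[fun_prop]
lemma hasTemperateGrowth_apply_ofReal {M : ℕ} (k : Fin M) :
    (fun x : Config M => (x k : ℂ)).HasTemperateGrowth :=
  (Complex.ofRealCLM.comp (EuclideanSpace.proj (𝕜 := ℝ) k)).hasTemperateGrowth

section Gaussian

variable {V : Type*} [NormedAddCommGroup V] [InnerProductSpace ℝ V] [FiniteDimensional ℝ V]
  [MeasurableSpace V] [BorelSpace V]

lemma memLp_exp_neg_mul_norm_sq {a : ℝ} (ha : 0 < a) :
    MemLp (fun x : V => Real.exp (-(a * ‖x‖ ^ 2))) 2 := by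
  rw [memLp_two_iff_integrable_sq (by fun_prop)]
  have hre : 0 < ((2 * a : ℝ) : ℂ).re := by
    rw [Complex.ofReal_re]
    positivity
  refine (GaussianFourier.integrable_cexp_neg_mul_sq_norm_add (V := V) hre 0 0).norm.congr
    (Filter.Eventually.of_forall fun x => ?_)
  simp only [zero_mul, add_zero, Complex.norm_exp, ← Real.exp_nat_mul]
  norm_cast
  congr 1
  ring

/-- Completing the square absorbs `exp t` into half of the Gaussian decay. -/
lemma one_add_pow_mul_exp_neg_le (n : ℕ) {a t : ℝ} (ha : 0 < a) (ht : 0 ≤ t) :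
    (1 + t) ^ n * Real.exp (-(2 * a * t ^ 2)) ≤
      n.factorial * Real.exp (1 + 1 / (4 * a)) * Real.exp (-(a * t ^ 2)) := by
  have hpow : (1 + t) ^ n ≤ n.factorial * Real.exp (1 + t) :=
    (div_le_iff₀' (by positivity)).1 (Real.pow_div_factorial_le_exp (1 + t) (by positivity) n)
  have hsquare : t ≤ a * t ^ 2 + 1 / (4 * a) := by
    have h : 0 ≤ a * (t - 1 / (2 * a)) ^ 2 := by positivity
    have e : a * (t - 1 / (2 * a)) ^ 2 = a * t ^ 2 + 1 / (4 * a) - t := by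
      field_simp
      ring
    linarith
  calc (1 + t) ^ n * Real.exp (-(2 * a * t ^ 2))
      ≤ n.factorial * Real.exp (1 + t) * Real.exp (-(2 * a * t ^ 2)) := by gcongr
    _ = n.factorial * Real.exp (1 + t - 2 * a * t ^ 2) := by
        rw [mul_assoc, ← Real.exp_add, sub_eq_add_neg]
    _ ≤ n.factorial * Real.exp (1 + 1 / (4 * a) + -(a * t ^ 2)) := by
        gcongr
        linarith
    _ = _ := by rw [Real.exp_add, mul_assoc]

lemma memLp_mul_of_norm_eq_gaussian {P g : V → ℂ} {a K : ℝ} (hP : P.HasTemperateGrowth)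
    (hg : AEStronglyMeasurable g) (ha : 0 < a)
    (hnorm : ∀ x, ‖g x‖ = K * Real.exp (-(2 * a * ‖x‖ ^ 2))) : MemLp (fun x => P x * g x) 2 := by
  obtain ⟨n, C, hC⟩ := hP.2 0
  simp only [norm_iteratedFDeriv_zero] at hC
  refine (memLp_exp_neg_mul_norm_sq ha).of_le_mul
    (c := C * (n.factorial * Real.exp (1 + 1 / (4 * a))) * K)
    (hP.1.continuous.aestronglyMeasurable.mul hg) (Filter.Eventually.of_forall fun x => ?_)
  have hK : 0 ≤ K := by
    have := hnorm x ▸ norm_nonneg (g x)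
    exact nonneg_of_mul_nonneg_left this (Real.exp_pos _)
  have hC0 : 0 ≤ C := by simpa using (norm_nonneg _).trans (hC 0)
  rw [norm_mul, hnorm, Real.norm_of_nonneg (Real.exp_pos _).le]
  calc ‖P x‖ * (K * Real.exp (-(2 * a * ‖x‖ ^ 2)))
      ≤ C * (1 + ‖x‖) ^ n * (K * Real.exp (-(2 * a * ‖x‖ ^ 2))) := by
        gcongr
        exact hC x
    _ = C * K * ((1 + ‖x‖) ^ n * Real.exp (-(2 * a * ‖x‖ ^ 2))) := by ring
    _ ≤ C * K * (n.factorial * Real.exp (1 + 1 / (4 * a)) * Real.exp (-(a * ‖x‖ ^ 2))) := by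
        gcongr C * K * ?_
        exact one_add_pow_mul_exp_neg_le n ha (norm_nonneg x)
    _ = _ := by ring

end Gaussian

/-- The constant that normalizes the single-mode wavefunction. -/
def cubicNorm (s : ℝ) : ℝ := (Real.sqrt s * Real.pi ^ (1 / 4 : ℝ))⁻¹

/-- The coefficient of the operator `∂ₖ + w(x̂ₖ)` that annihilates the cubic phase state. -/
def lowerCoeff (s γ t : ℝ) : ℂ := t * ((s : ℂ) ^ 2)⁻¹ - 3 * Complex.I * γ * (t : ℂ) ^ 2

/-- The cubic phase states displaced in momentum by `b`. -/
def displacedFun (s γ : ℝ) {M : ℕ} (b x : Config M) : ℂ :=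
  Complex.exp (Complex.I * (⟪b, x⟫_ℝ : ℂ)) * cubicFun s γ M x

section Displaced

variable {s γ : ℝ} {M : ℕ}

lemma cubicNorm_nonneg : 0 ≤ cubicNorm s := by
  unfold cubicNorm
  positivity

lemma cubicNorm_pos (hs : 0 < s) : 0 < cubicNorm s := by
  unfold cubicNorm
  positivity

lemma cubicNorm_sq (hs : 0 < s) : cubicNorm s ^ 2 = (Real.sqrt Real.pi * s)⁻¹ := by
  rw [cubicNorm, inv_pow, mul_pow, Real.sq_sqrt hs.le, ← Real.rpow_natCast,
    ← Real.rpow_mul Real.pi_pos.le, Real.sqrt_eq_rpow, mul_comm]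
  norm_num

lemma cubicFun_eq_mul_exp (x : Config M) : cubicFun s γ M x = (cubicNorm s : ℂ) ^ M *
    Complex.exp (∑ k, (Complex.I * γ * (x k : ℂ) ^ 3 - (x k : ℂ) ^ 2 * (2 * (s : ℂ) ^ 2)⁻¹)) := by
  simp only [cubicFun, cubicNorm, Complex.exp_sum, div_eq_mul_inv, Finset.prod_mul_distrib,
    Finset.prod_const, Finset.card_univ, Fintype.card_fin, Complex.exp_sub, neg_mul,
    Complex.exp_neg]
  push_cast
  ring

lemma contDiff_cubicFun : ContDiff ℝ ∞ (cubicFun s γ M) := by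
  have h := contDiff_apply_ofReal (M := M)
  rw [funext cubicFun_eq_mul_exp]
  fun_prop

lemma fderiv_cubicFun_axis (k : Fin M) (x : Config M) :
    fderiv ℝ (cubicFun s γ M) x (axis k) = -lowerCoeff s γ (x k) * cubicFun s γ M x := by
  have hexponent : ∀ t : ℝ, HasDerivAt
      (fun t : ℝ => Complex.I * γ * (t : ℂ) ^ 3 - (t : ℂ) ^ 2 * (2 * (s : ℂ) ^ 2)⁻¹)
      (-lowerCoeff s γ t) t := fun t => by
    have h := (Complex.ofRealCLM.hasDerivAt (x := t)).pow
    convert! ((h 3).const_mul (Complex.I * γ)).sub ((h 2).mul_const (2 * (s : ℂ) ^ 2)⁻¹) using 1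
    simp only [lowerCoeff, Complex.ofRealCLM_apply, mul_inv, Complex.ofReal_one]
    push_cast
    ring
  have hsum := HasFDerivAt.fun_sum (u := Finset.univ) fun l _ =>
    hasFDerivAt_comp_apply l (hexponent (x l))
  rw [funext cubicFun_eq_mul_exp, (hsum.cexp.const_mul _).fderiv]
  simp only [smul_apply, smul_eq_mul, ← hsum.fderiv,
    fderiv_sum_comp_apply_axis (fun l => hexponent (x l)) k]
  ring

lemma norm_cubicFun (x : Config M) :
    ‖cubicFun s γ M x‖ = cubicNorm s ^ M * Real.exp (-(2 * (1 / (4 * s ^ 2)) * ‖x‖ ^ 2)) := by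
  rw [cubicFun_eq_mul_exp, norm_mul, norm_pow, Complex.norm_real,
    Real.norm_of_nonneg cubicNorm_nonneg, Complex.norm_exp, Complex.re_sum,
    EuclideanSpace.norm_sq_eq, Finset.mul_sum, ← Finset.sum_neg_distrib]
  congr 3 with k
  have hparts : Complex.I * γ * (x k : ℂ) ^ 3 - (x k : ℂ) ^ 2 * (2 * (s : ℂ) ^ 2)⁻¹ =
      ((-(2 * (1 / (4 * s ^ 2)) * x k ^ 2) : ℝ) : ℂ) + ((γ * x k ^ 3 : ℝ) : ℂ) * Complex.I := by
    push_cast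
    ring
  rw [hparts, Complex.add_re, Complex.ofReal_re, Complex.re_ofReal_mul, Complex.I_re, mul_zero,
    add_zero, Real.norm_eq_abs, sq_abs]

lemma coeFn_cubic (hs : 0 < s) : cubic s hs γ M =ᵐ[volume] cubicFun s γ M :=
  (memLp_cubicFun hs γ M).coeFn_toLp

lemma norm_cubic (hs : 0 < s) : ‖cubic s hs γ M‖ = 1 := by
  have hpos : 0 < Real.sqrt Real.pi * s := by positivity
  have hwidth : Real.pi / (1 / s ^ 2) = (Real.sqrt Real.pi * s) ^ 2 := by
    rw [mul_pow, Real.sq_sqrt Real.pi_pos.le]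
    field_simp
  have hsq : ∀ x : Config M, ‖cubicFun s γ M x‖ ^ 2 =
      ((Real.sqrt Real.pi * s)⁻¹) ^ M * Real.exp (-(1 / s ^ 2) * ‖x‖ ^ 2) := fun x => by
    rw [norm_cubicFun, mul_pow, ← pow_mul, mul_comm M, pow_mul, cubicNorm_sq hs,
      ← Real.exp_nat_mul]
    congr 2
    push_cast
    ring
  have hnorm : ‖cubic s hs γ M‖ ^ 2 = 1 := by
    rw [norm_sq_eq_integral_of_ae_eq (coeFn_cubic hs)]
    simp only [hsq]
    rw [integral_const_mul, GaussianFourier.integral_rexp_neg_mul_sq_norm (by positivity), hwidth,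
      finrank_euclideanSpace, Fintype.card_fin, ← Real.rpow_natCast (_ * _) 2,
      ← Real.rpow_mul hpos.le, Nat.cast_ofNat, mul_div_cancel₀ _ two_ne_zero, Real.rpow_natCast,
      ← mul_pow, inv_mul_cancel₀ hpos.ne', one_pow]
  exact (pow_eq_one_iff_of_nonneg (norm_nonneg _) two_ne_zero).1 hnorm

@[fun_prop]
lemma hasTemperateGrowth_inner_ofReal (b : Config M) :
    (fun x : Config M => (⟪b, x⟫_ℝ : ℂ)).HasTemperateGrowth :=
  (Complex.ofRealCLM.comp (innerSL ℝ b)).hasTemperateGrowth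

lemma fderiv_inner_axis (b x : Config M) (k : Fin M) :
    fderiv ℝ (fun x : Config M => (⟪b, x⟫_ℝ : ℂ)) x (axis k) = b k := by
  have h : fderiv ℝ (fun x : Config M => (⟪b, x⟫_ℝ : ℂ)) x = _ :=
    (Complex.ofRealCLM.comp (innerSL ℝ b)).fderiv
  simp [h, EuclideanSpace.inner_single_right]

@[simp]
lemma displacedFun_zero (x : Config M) : displacedFun s γ 0 x = cubicFun s γ M x := by
  simp [displacedFun]

lemma contDiff_displacedFun (b : Config M) : ContDiff ℝ ∞ (displacedFun s γ b) :=
  (contDiff_const.mul (hasTemperateGrowth_inner_ofReal b).1).cexp.mul contDiff_cubicFun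

lemma fderiv_displacedFun_axis (k : Fin M) (b x : Config M) :
    fderiv ℝ (displacedFun s γ b) x (axis k) =
      (Complex.I * b k - lowerCoeff s γ (x k)) * displacedFun s γ b x := by
  have hinner := (hasTemperateGrowth_inner_ofReal b).1.differentiable (by simp) x
  have hphase := (hinner.hasFDerivAt.const_mul Complex.I).cexp
  have hmul : fderiv ℝ (displacedFun s γ b) x (axis k) = _ :=
    fderiv_mul_apply hphase.differentiableAt (contDiff_cubicFun.differentiable (by simp) x) (axis k)
  rw [hmul, hphase.fderiv, fderiv_cubicFun_axis]
  simp only [displacedFun, smul_apply, smul_eq_mul, fderiv_inner_axis]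
  ring

lemma norm_displacedFun (b x : Config M) : ‖displacedFun s γ b x‖ = ‖cubicFun s γ M x‖ := by
  rw [displacedFun, norm_mul, mul_comm Complex.I, Complex.norm_exp_ofReal_mul_I, one_mul]

lemma displacedFun_ne_zero (hs : 0 < s) (b x : Config M) : displacedFun s γ b x ≠ 0 := by
  rw [← norm_ne_zero_iff, norm_displacedFun, norm_cubicFun]
  have := cubicNorm_pos hs
  positivity

lemma star_displacedFun (b x : Config M) :
    star (displacedFun s γ b x) = displacedFun s (-γ) (-b) x := by
  simp only [displacedFun, cubicFun_eq_mul_exp, Complex.star_def, map_mul, map_pow,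
    Complex.conj_ofReal, ← Complex.exp_conj, map_sum, map_sub, map_inv₀, Complex.conj_I, map_ofNat,
    inner_neg_left, Complex.ofReal_neg, mul_neg, neg_mul]

lemma memLp_mul_displacedFun (hs : 0 < s) (b : Config M) {P : Config M → ℂ}
    (hP : P.HasTemperateGrowth) : MemLp (fun x => P x * displacedFun s γ b x) 2 :=
  memLp_mul_of_norm_eq_gaussian hP (contDiff_displacedFun b).continuous.aestronglyMeasurable
    (by positivity) fun x => (norm_displacedFun b x).trans (norm_cubicFun x)

lemma memLp_displacedFun (hs : 0 < s) (b : Config M) : MemLp (displacedFun s γ b) 2 := by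
  simpa using memLp_mul_displacedFun (γ := γ) hs b (P := fun _ => 1) (by fun_prop)

lemma integrable_mul_star_displacedFun_mul (hs : 0 < s) (b : Config M) (f : Wave M)
    {P : Config M → ℂ} (hP : P.HasTemperateGrowth) :
    Integrable fun x => P x * star (displacedFun s γ b x) * f x := by
  simp only [star_displacedFun]
  exact (memLp_mul_displacedFun hs (-b) hP).integrable_mul (Lp.memLp f)

lemma integrable_star_displacedFun_mul (hs : 0 < s) (b : Config M) (f : Wave M) :
    Integrable fun x => star (displacedFun s γ b x) * f x := by
  simpa using integrable_mul_star_displacedFun_mul hs b f (P := fun _ => 1) (by fun_prop)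

end Displaced

/-! ### A duality argument -/

section Duality

variable {ι H K L : Type*} [NormedAddCommGroup H] [InnerProductSpace ℂ H]
  [NormedAddCommGroup K] [InnerProductSpace ℂ K] [NormedAddCommGroup L] [InnerProductSpace ℂ L]
  {n : ι → H} {d : ι → K} {t : ι → L}

lemma norm_linearCombination_le_of_inner_eq_add
    (h : ∀ i j, ⟪n i, n j⟫_ℂ = ⟪d i, d j⟫_ℂ + ⟪t i, t j⟫_ℂ) (a : ι →₀ ℂ) :
    ‖Finsupp.linearCombination ℂ d a‖ ≤ ‖Finsupp.linearCombination ℂ n a‖ := by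
  have hinner : ⟪Finsupp.linearCombination ℂ n a, Finsupp.linearCombination ℂ n a⟫_ℂ =
      ⟪Finsupp.linearCombination ℂ d a, Finsupp.linearCombination ℂ d a⟫_ℂ +
        ⟪Finsupp.linearCombination ℂ t a, Finsupp.linearCombination ℂ t a⟫_ℂ := by
    simp only [Finsupp.linearCombination_apply, Finsupp.sum, sum_inner, inner_sum,
      inner_smul_left, inner_smul_right, h, mul_add, Finset.sum_add_distrib]
  have hnorm : ‖Finsupp.linearCombination ℂ n a‖ ^ 2 =
      ‖Finsupp.linearCombination ℂ d a‖ ^ 2 + ‖Finsupp.linearCombination ℂ t a‖ ^ 2 := by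
    simp only [inner_self_eq_norm_sq_to_K] at hinner
    exact_mod_cast hinner
  rw [← sq_le_sq₀ (norm_nonneg _) (norm_nonneg _), hnorm]
  exact le_add_of_nonneg_right (sq_nonneg _)

lemma norm_le_of_mem_closure_span {f : H} {y : K}
    (hle : ∀ a : ι →₀ ℂ,
      ‖Finsupp.linearCombination ℂ d a‖ ≤ ‖Finsupp.linearCombination ℂ n a‖)
    (hinner : ∀ i, ⟪n i, f⟫_ℂ = ⟪d i, y⟫_ℂ)
    (hf : f ∈ (Submodule.span ℂ (Set.range n)).topologicalClosure) : ‖f‖ ≤ ‖y‖ := by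
  have hspan : ∀ v ∈ Submodule.span ℂ (Set.range n), ‖⟪v, f⟫_ℂ‖ ≤ ‖v‖ * ‖y‖ := by
    intro v hv
    obtain ⟨a, rfl⟩ := Finsupp.mem_span_range_iff_exists_finsupp.1 hv
    have hdual : ⟪a.sum fun i c => c • n i, f⟫_ℂ = ⟪Finsupp.linearCombination ℂ d a, y⟫_ℂ := by
      simp only [Finsupp.linearCombination_apply, Finsupp.sum, sum_inner, inner_smul_left, hinner]
    rw [hdual]
    exact (norm_inner_le_norm _ _).trans (mul_le_mul_of_nonneg_right (hle a) (norm_nonneg _))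
  have hself : ‖⟪f, f⟫_ℂ‖ ≤ ‖f‖ * ‖y‖ :=
    closure_minimal (t := {v | ‖⟪v, f⟫_ℂ‖ ≤ ‖v‖ * ‖y‖}) hspan
      (isClosed_le (by fun_prop) (by fun_prop)) hf
  rw [inner_self_eq_norm_sq_to_K, norm_pow, RCLike.norm_ofReal, abs_norm, sq] at hself
  obtain h0 | hpos := (norm_nonneg f).eq_or_lt
  · exact h0 ▸ norm_nonneg y
  · exact le_of_mul_le_mul_left hself hpos

end Duality

/-! ### The transported number operator -/

section NumberOperator

variable {s γ : ℝ} {M : ℕ}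

/-- The displaced cubic phase states as vectors. -/
def displacedWave (hs : 0 < s) (γ : ℝ) (b : Config M) : Wave M :=
  (memLp_displacedFun (γ := γ) hs b).toLp _

/-- The factor by which the number operator transported to the cubic phase state multiplies the
state displaced by `b`. -/
def numberFactor (s : ℝ) (b x : Config M) : ℂ :=
  Complex.I * (⟪b, x⟫_ℝ : ℂ) + (s : ℂ) ^ 2 / 2 * (‖b‖ : ℂ) ^ 2

lemma hasTemperateGrowth_numberFactor (b : Config M) :
    (numberFactor s b).HasTemperateGrowth := by
  unfold numberFactor
  fun_prop

lemma fderiv_numberFactor_axis (k : Fin M) (b x : Config M) :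
    fderiv ℝ (numberFactor s b) x (axis k) = Complex.I * b k := by
  have hinner := ((hasTemperateGrowth_inner_ofReal b).1.differentiable (by simp) x).hasFDerivAt
  have h : fderiv ℝ (numberFactor s b) x = _ :=
    ((hinner.const_mul Complex.I).add_const _).fderiv
  rw [h, smul_apply, fderiv_inner_axis, smul_eq_mul]

/-- The image of `displacedWave` under the number operator transported to the cubic phase state. -/
def numberWave (hs : 0 < s) (γ : ℝ) (b : Config M) : Wave M :=
  (memLp_mul_displacedFun (γ := γ) hs b (hasTemperateGrowth_numberFactor (s := s) b)).toLp _

lemma coeFn_displacedWave (hs : 0 < s) (b : Config M) :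
    displacedWave hs γ b =ᵐ[volume] displacedFun s γ b := (memLp_displacedFun hs b).coeFn_toLp

lemma coeFn_numberWave (hs : 0 < s) (b : Config M) :
    numberWave hs γ b =ᵐ[volume] fun x => numberFactor s b x * displacedFun s γ b x :=
  (memLp_mul_displacedFun hs b (hasTemperateGrowth_numberFactor b)).coeFn_toLp

lemma displacedWave_zero (hs : 0 < s) : displacedWave hs γ (0 : Config M) = cubic s hs γ M := by
  refine Lp.ext ?_
  filter_upwards [coeFn_displacedWave (γ := γ) hs (0 : Config M), coeFn_cubic (γ := γ) hs]
    with x hx hx'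
  rw [hx, hx', displacedFun_zero]

/-- The vector `B` is the image of `f` under the operator `∂ₖ + xₖ/s² - 3iγxₖ²`, that is, up to a
factor, under the annihilation operator of the cubic phase state in mode `k`. -/
def IsLowered (s γ : ℝ) (k : Fin M) (f B : Wave M) : Prop :=
  ∃ u : Wave M, HasWeakDeriv (axis k) f u ∧
    B =ᵐ[volume] fun x => u x + lowerCoeff s γ (x k) * f x

lemma hasTemperateGrowth_lowerCoeff (k : Fin M) :
    (fun x : Config M => lowerCoeff s γ (x k)).HasTemperateGrowth := by
  unfold lowerCoeff
  fun_prop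

lemma isLowered_of_ae_eq_mul_displacedFun (hs : 0 < s) {k : Fin M} {b : Config M} {f B : Wave M}
    {P : Config M → ℂ} (hP : P.HasTemperateGrowth)
    (hf : f =ᵐ[volume] fun x => P x * displacedFun s γ b x)
    (hB : B =ᵐ[volume] fun x =>
      (fderiv ℝ P x (axis k) + Complex.I * b k * P x) * displacedFun s γ b x) :
    IsLowered s γ k f B := by
  have hw := memLp_mul_displacedFun (γ := γ) hs b
    ((hasTemperateGrowth_lowerCoeff (s := s) (γ := γ) k).mul hP)
  have hsub := Lp.coeFn_sub B (hw.toLp _)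
  refine ⟨B - hw.toLp _, (HasWeakDeriv.of_contDiff (hP.1.mul (contDiff_displacedFun b))).congr
    hf.symm ?_, ?_⟩
  · filter_upwards [hsub, hw.coeFn_toLp, hB] with x hsub hw hB
    rw [hsub, Pi.sub_apply, hw, hB, fderiv_mul_apply (hP.1.differentiable (by simp) x)
      ((contDiff_displacedFun b).differentiable (by simp) x), fderiv_displacedFun_axis]
    simp only [Pi.mul_apply]
    ring
  · filter_upwards [hsub, hw.coeFn_toLp, hf] with x hsub hw hf
    rw [hsub, Pi.sub_apply, hw, hf, Pi.mul_apply]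
    ring

lemma isLowered_displacedWave (hs : 0 < s) (b : Config M) (k : Fin M) :
    IsLowered s γ k (displacedWave hs γ b) ((Complex.I * b k) • displacedWave hs γ b) := by
  refine isLowered_of_ae_eq_mul_displacedFun hs (b := b) (P := fun _ => 1) (by fun_prop)
    (by simpa using coeFn_displacedWave hs b) ?_
  filter_upwards [Lp.coeFn_smul (Complex.I * b k) (displacedWave hs γ b),
    coeFn_displacedWave (γ := γ) hs b] with x hsmul hx
  rw [hsmul, Pi.smul_apply, hx]
  simp

lemma isLowered_numberWave (hs : 0 < s) (b : Config M) (k : Fin M) :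
    IsLowered s γ k (numberWave hs γ b)
      ((Complex.I * b k) • (numberWave hs γ b + displacedWave hs γ b)) := by
  refine isLowered_of_ae_eq_mul_displacedFun hs (hasTemperateGrowth_numberFactor b)
    (coeFn_numberWave hs b) ?_
  filter_upwards [Lp.coeFn_smul (Complex.I * b k) (numberWave hs γ b + displacedWave hs γ b),
    Lp.coeFn_add (numberWave hs γ b) (displacedWave hs γ b), coeFn_numberWave (γ := γ) hs b,
    coeFn_displacedWave (γ := γ) hs b] with x hsmul hadd hnumber hdisplaced
  rw [hsmul, Pi.smul_apply, hadd, Pi.add_apply, hnumber, hdisplaced, fderiv_numberFactor_axis,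
    smul_eq_mul]
  ring

lemma inner_displacedWave (hs : 0 < s) (b : Config M) (f : Wave M) :
    ⟪displacedWave hs γ b, f⟫_ℂ = ∫ x, star (displacedFun s γ b x) * f x :=
  inner_eq_integral_of_ae_eq (coeFn_displacedWave hs b) .rfl

lemma inner_numberWave (hs : 0 < s) (b : Config M) (f : Wave M) :
    ⟪numberWave hs γ b, f⟫_ℂ =
      ∫ x, star (numberFactor s b x) * star (displacedFun s γ b x) * f x := by
  rw [inner_eq_integral_of_ae_eq (coeFn_numberWave hs b) (v := f) .rfl]
  simp only [star_mul']

lemma star_numberFactor (b x : Config M) : star (numberFactor s b x) =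
    -(Complex.I * (⟪b, x⟫_ℝ : ℂ)) + (s : ℂ) ^ 2 / 2 * (‖b‖ : ℂ) ^ 2 := by
  simp [numberFactor]

lemma integral_star_displacedFun_mul_weakDeriv (hs : 0 < s) (b : Config M) {k : Fin M}
    {f u : Wave M} (h : HasWeakDeriv (axis k) f u) :
    ∫ x, star (displacedFun s γ b x) * u x = ∫ x, (Complex.I * b k + lowerCoeff s (-γ) (x k)) *
      star (displacedFun s γ b x) * f x := by
  have hlower := hasTemperateGrowth_lowerCoeff (s := s) (γ := -γ) k
  simp only [star_displacedFun]
  have hfderiv : ∀ x, fderiv ℝ (displacedFun s (-γ) (-b)) x (axis k) =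
      -(Complex.I * b k + lowerCoeff s (-γ) (x k)) * displacedFun s (-γ) (-b) x := fun x => by
    rw [fderiv_displacedFun_axis, PiLp.neg_apply, Complex.ofReal_neg]
    ring
  have hparts := h.integral_eq_of_memLp (Lp.memLp f) (Lp.memLp u)
    (contDiff_displacedFun (s := s) (γ := -γ) (-b)) (memLp_displacedFun hs _) (by
      simp only [hfderiv]
      exact memLp_mul_displacedFun hs _ (by fun_prop))
  rw [← neg_eq_iff_eq_neg, ← integral_neg] at hparts
  simpa only [hfderiv, neg_mul, neg_neg] using hparts.symm

lemma IsLowered.inner_displacedWave (hs : 0 < s) {k : Fin M} {f B : Wave M}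
    (h : IsLowered s γ k f B) (b : Config M) : ⟪displacedWave hs γ b, B⟫_ℂ =
      ∫ x, (Complex.I * b k + 2 * x k * ((s : ℂ) ^ 2)⁻¹) * star (displacedFun s γ b x) * f x := by
  obtain ⟨u, hu, hB⟩ := h
  have hlower := fun γ : ℝ => hasTemperateGrowth_lowerCoeff (s := s) (γ := γ) k
  calc ⟪displacedWave hs γ b, B⟫_ℂ
      = ∫ x, (star (displacedFun s γ b x) * u x +
          lowerCoeff s γ (x k) * star (displacedFun s γ b x) * f x) := by
        rw [inner_eq_integral_of_ae_eq (coeFn_displacedWave hs b) hB]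
        congr 1 with x
        ring
    _ = ∫ x, ((Complex.I * b k + lowerCoeff s (-γ) (x k)) * star (displacedFun s γ b x) * f x +
          lowerCoeff s γ (x k) * star (displacedFun s γ b x) * f x) := by
        rw [integral_add (integrable_star_displacedFun_mul hs b u)
            (integrable_mul_star_displacedFun_mul hs b f (hlower γ)),
          integral_star_displacedFun_mul_weakDeriv hs b hu,
          ← integral_add (integrable_mul_star_displacedFun_mul hs b f (by fun_prop))
            (integrable_mul_star_displacedFun_mul hs b f (hlower γ))]
    _ = _ := by
        congr 1 with x
        simp only [lowerCoeff]
        push_cast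
        ring

lemma inner_numberWave_of_isLowered (hs : 0 < s) {f : Wave M} {B : Fin M → Wave M}
    (h : ∀ k, IsLowered s γ k f (B k)) (b : Config M) :
    ⟪numberWave hs γ b, f⟫_ℂ =
      ∑ k, (s : ℂ) ^ 2 / 2 * -(Complex.I * b k) * ⟪displacedWave hs γ b, B k⟫_ℂ := by
  have hs' : (s : ℂ) ≠ 0 := Complex.ofReal_ne_zero.2 hs.ne'
  have hfactor : ∀ x, star (numberFactor s b x) = ∑ k, (s : ℂ) ^ 2 / 2 * -(Complex.I * b k) *
      (Complex.I * b k + 2 * x k * ((s : ℂ) ^ 2)⁻¹) := fun x => by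
    have hnorm : (‖b‖ : ℂ) ^ 2 = ∑ k, (b k : ℂ) ^ 2 := by
      exact_mod_cast EuclideanSpace.real_norm_sq_eq b
    have hinner : (⟪b, x⟫_ℝ : ℂ) = ∑ k, (b k : ℂ) * x k := by
      simp [PiLp.inner_apply, mul_comm]
    rw [star_numberFactor, hnorm, hinner, Finset.mul_sum, Finset.mul_sum, ← Finset.sum_neg_distrib,
      ← Finset.sum_add_distrib]
    refine Finset.sum_congr rfl fun k _ => ?_
    field_simp
    linear_combination (s : ℂ) ^ 2 * (b k : ℂ) ^ 2 * Complex.I_sq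
  simp only [inner_numberWave, (h _).inner_displacedWave hs, hfactor, Finset.sum_mul]
  rw [integral_finsetSum _ fun k _ =>
    integrable_mul_star_displacedFun_mul hs b f (by fun_prop)]
  simp only [← integral_const_mul, mul_assoc]

lemma inner_numberWave_cubic (hs : 0 < s) (b : Config M) :
    ⟪numberWave hs γ b, cubic s hs γ M⟫_ℂ = 0 := by
  rw [← displacedWave_zero, inner_numberWave_of_isLowered hs (isLowered_displacedWave hs 0)]
  simp

/-- The annihilation operators of the `M` modes, applied to `displacedWave`. -/
def loweredWave (hs : 0 < s) (γ : ℝ) (b : Config M) : PiLp 2 fun _ : Fin M => Wave M :=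
  WithLp.toLp 2 fun k => ((s / Real.sqrt 2 : ℝ) * (Complex.I * b k)) • displacedWave hs γ b

/-- The products of two annihilation operators, applied to `displacedWave`. -/
def twiceLoweredWave (hs : 0 < s) (γ : ℝ) (b : Config M) :
    PiLp 2 fun _ : Fin M × Fin M => Wave M :=
  WithLp.toLp 2 fun k => ((s ^ 2 / 2 * (b k.1 * b k.2) : ℝ) : ℂ) • displacedWave hs γ b

lemma ofReal_div_sqrt_two_sq : ((s / Real.sqrt 2 : ℝ) : ℂ) ^ 2 = (s : ℂ) ^ 2 / 2 := by
  rw [← Complex.ofReal_pow, div_pow, Real.sq_sqrt two_pos.le]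
  push_cast
  rfl

lemma inner_numberWave_eq_inner_loweredWave (hs : 0 < s) {f : Wave M} {B : Fin M → Wave M}
    (h : ∀ k, IsLowered s γ k f (B k)) (b : Config M) : ⟪numberWave hs γ b, f⟫_ℂ =
      ⟪loweredWave hs γ b, WithLp.toLp 2 fun k => ((s / Real.sqrt 2 : ℝ) : ℂ) • B k⟫_ℂ := by
  rw [inner_numberWave_of_isLowered hs h, PiLp.inner_apply]
  refine Finset.sum_congr rfl fun k _ => ?_
  simp only [loweredWave, inner_smul_left, inner_smul_right, map_mul, Complex.conj_ofReal,
    Complex.conj_I, ← ofReal_div_sqrt_two_sq]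
  ring

lemma inner_loweredWave_loweredWave (hs : 0 < s) (b c : Config M) :
    ⟪loweredWave hs γ b, loweredWave hs γ c⟫_ℂ =
      (∑ k, (s : ℂ) ^ 2 / 2 * (b k * c k)) * ⟪displacedWave hs γ b, displacedWave hs γ c⟫_ℂ := by
  rw [PiLp.inner_apply, Finset.sum_mul]
  refine Finset.sum_congr rfl fun k _ => ?_
  simp only [loweredWave, inner_smul_left, inner_smul_right, map_mul, Complex.conj_ofReal,
    Complex.conj_I, ← ofReal_div_sqrt_two_sq]
  linear_combination (-((s / Real.sqrt 2 : ℝ) : ℂ) ^ 2 * b k * c k *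
    ⟪displacedWave hs γ b, displacedWave hs γ c⟫_ℂ) * Complex.I_sq

lemma inner_twiceLoweredWave_twiceLoweredWave (hs : 0 < s) (b c : Config M) :
    ⟪twiceLoweredWave hs γ b, twiceLoweredWave hs γ c⟫_ℂ =
      (∑ k, (s : ℂ) ^ 2 / 2 * (b k * c k)) ^ 2 *
        ⟪displacedWave hs γ b, displacedWave hs γ c⟫_ℂ := by
  rw [PiLp.inner_apply, Fintype.sum_prod_type, sq, Finset.sum_mul_sum, Finset.sum_mul]
  refine Finset.sum_congr rfl fun k _ => ?_
  rw [Finset.sum_mul]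
  refine Finset.sum_congr rfl fun l _ => ?_
  simp only [twiceLoweredWave, inner_smul_left, inner_smul_right, Complex.conj_ofReal]
  push_cast
  ring

lemma inner_numberWave_displacedWave (hs : 0 < s) (b c : Config M) :
    ⟪numberWave hs γ b, displacedWave hs γ c⟫_ℂ =
      (∑ k, (s : ℂ) ^ 2 / 2 * (b k * c k)) * ⟪displacedWave hs γ b, displacedWave hs γ c⟫_ℂ := by
  rw [inner_numberWave_of_isLowered hs (isLowered_displacedWave hs c), Finset.sum_mul]
  refine Finset.sum_congr rfl fun k _ => ?_
  rw [inner_smul_right]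
  linear_combination (-((s : ℂ) ^ 2 / 2) * b k * c k *
    ⟪displacedWave hs γ b, displacedWave hs γ c⟫_ℂ) * Complex.I_sq

lemma inner_displacedWave_numberWave (hs : 0 < s) (b c : Config M) :
    ⟪displacedWave hs γ b, numberWave hs γ c⟫_ℂ =
      (∑ k, (s : ℂ) ^ 2 / 2 * (b k * c k)) * ⟪displacedWave hs γ b, displacedWave hs γ c⟫_ℂ := by
  rw [← inner_conj_symm, inner_numberWave_displacedWave, map_mul, inner_conj_symm, map_sum]
  refine congrArg (· * _) (Finset.sum_congr rfl fun k _ => ?_)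
  simp only [map_mul, map_div₀, map_pow, Complex.conj_ofReal, map_ofNat]
  ring

/-- With `n` the number operator and `aₖ` the annihilation operators, this is
`n² = ∑ₖ aₖ† aₖ + ∑ₖₗ aₖ† aₗ† aₗ aₖ`. -/
lemma inner_numberWave_numberWave (hs : 0 < s) (b c : Config M) :
    ⟪numberWave hs γ b, numberWave hs γ c⟫_ℂ = ⟪loweredWave hs γ b, loweredWave hs γ c⟫_ℂ +
      ⟪twiceLoweredWave hs γ b, twiceLoweredWave hs γ c⟫_ℂ := by
  have hnumber := inner_displacedWave_numberWave (γ := γ) hs b c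
  rw [inner_loweredWave_loweredWave, inner_twiceLoweredWave_twiceLoweredWave,
    inner_numberWave_of_isLowered hs (isLowered_numberWave hs c)]
  set κ := ∑ k, (s : ℂ) ^ 2 / 2 * (b k * c k) with hκ
  set G := ⟪displacedWave hs γ b, displacedWave hs γ c⟫_ℂ
  calc ∑ k, (s : ℂ) ^ 2 / 2 * -(Complex.I * b k) * ⟪displacedWave hs γ b,
        (Complex.I * c k) • (numberWave hs γ c + displacedWave hs γ c)⟫_ℂ
      = ∑ k, (s : ℂ) ^ 2 / 2 * (b k * c k) * (κ * G + G) := by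
        refine Finset.sum_congr rfl fun k _ => ?_
        rw [inner_smul_right, inner_add_right, hnumber]
        linear_combination (-((s : ℂ) ^ 2 / 2) * b k * c k * (κ * G + G)) * Complex.I_sq
    _ = κ * G + κ ^ 2 * G := by
        rw [← Finset.sum_mul, ← hκ]
        ring

end NumberOperator

/-! ### Totality and the spectral gap -/

section FourierInjective

variable {V : Type*} [NormedAddCommGroup V] [InnerProductSpace ℝ V] [FiniteDimensional ℝ V]
  [MeasurableSpace V] [BorelSpace V]

lemma ae_eq_zero_of_fourier_eq_zero {h : V → ℂ} (hi : Integrable h) (hF : ∀ w, 𝓕 h w = 0) :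
    h =ᵐ[volume] 0 := by
  refine ae_eq_zero_of_integral_contDiff_smul_eq_zero hi.locallyIntegrable fun g hg hg' => ?_
  have hgc : ContDiff ℝ ∞ fun x => (g x : ℂ) := Complex.ofRealCLM.contDiff.comp hg
  have hgc' : HasCompactSupport fun x => (g x : ℂ) := hg'.comp_left Complex.ofReal_zero
  set G := 𝓕⁻ (hgc'.toSchwartzMap hgc)
  have hfourier : ∀ x, 𝓕 (G : V → ℂ) x = g x := fun x => by
    rw [← SchwartzMap.fourier_coe, FourierTransform.fourier_fourierInv_eq]
    rfl
  have hflip : ∫ w, 𝓕 h w • G w =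
      ∫ x, h x • 𝓕 (G : V → ℂ) x := by
    have := VectorFourier.integral_fourierIntegral_smul_eq_flip (L := innerₗ V) (μ := volume)
      (ν := volume) Real.continuous_fourierChar continuous_inner hi G.integrable
    rwa [flip_innerₗ] at this
  simp only [hF, hfourier, smul_eq_mul, zero_mul, integral_zero] at hflip
  simpa only [Complex.real_smul, mul_comm] using hflip.symm

end FourierInjective

section Totality

variable {s γ : ℝ} {M : ℕ}

lemma eq_zero_of_forall_inner_displacedWave_eq_zero (hs : 0 < s) {f : Wave M}
    (h : ∀ b, ⟪displacedWave hs γ b, f⟫_ℂ = 0) : f = 0 := by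
  have hzero := ae_eq_zero_of_fourier_eq_zero (integrable_star_displacedFun_mul hs 0 f) fun w => by
    rw [Real.fourier_eq', ← h ((2 * Real.pi) • w), inner_displacedWave]
    congr 1 with x
    have hphase : Complex.exp (↑(-2 * Real.pi * ⟪x, w⟫_ℝ) * Complex.I) =
        star (Complex.exp (Complex.I * (⟪(2 * Real.pi) • w, x⟫_ℝ : ℂ))) := by
      rw [Complex.star_def, ← Complex.exp_conj, map_mul, Complex.conj_I, Complex.conj_ofReal,
        real_inner_smul_left, real_inner_comm]
      congr 1
      push_cast
      ring
    rw [displacedFun_zero, displacedFun, star_mul', hphase, smul_eq_mul, mul_assoc]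
  refine Lp.eq_zero_iff_ae_eq_zero.2 (hzero.mono fun x hx => ?_)
  exact (mul_eq_zero.1 hx).resolve_left (star_ne_zero.2 (displacedFun_ne_zero hs 0 x))

lemma star_displacedFun_smul (r : ℝ) (b x : Config M) : star (displacedFun s γ (r • b) x) =
    Complex.exp (-(Complex.I * (⟪b, x⟫_ℝ : ℂ)) * r) * star (displacedFun s γ 0 x) := by
  rw [displacedFun_zero, displacedFun, star_mul', Complex.star_def, ← Complex.exp_conj, map_mul,
    Complex.conj_I, Complex.conj_ofReal, real_inner_smul_left, Complex.ofReal_mul]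
  ring_nf

lemma hasDerivAt_inner_displacedWave_smul (hs : 0 < s) (f : Wave M) (b : Config M) (r : ℝ) :
    HasDerivAt (fun r : ℝ => ⟪displacedWave hs γ (r • b), f⟫_ℂ)
      (∫ x, -(Complex.I * (⟪b, x⟫_ℝ : ℂ)) * star (displacedFun s γ (r • b) x) * f x) r := by
  have hint_deriv : ∀ c : Config M, Integrable fun x =>
      -(Complex.I * (⟪b, x⟫_ℝ : ℂ)) * star (displacedFun s γ c x) * f x := fun c =>
    integrable_mul_star_displacedFun_mul hs c f (by fun_prop)
  simp only [inner_displacedWave]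
  refine (hasDerivAt_integral_of_dominated_loc_of_deriv_le
    (F' := fun r x => -(Complex.I * (⟪b, x⟫_ℝ : ℂ)) * star (displacedFun s γ (r • b) x) * f x)
    Filter.univ_mem (.of_forall fun r => (integrable_star_displacedFun_mul hs (r • b) f).1)
    (integrable_star_displacedFun_mul hs (r • b) f) (hint_deriv (r • b)).1
    (.of_forall fun x r _ => ?_) (hint_deriv 0).norm (.of_forall fun x r _ => ?_)).2
  · simp only [norm_mul, norm_star, norm_displacedFun, le_refl]
  · have hexp := ((Complex.ofRealCLM.hasDerivAt (x := r)).const_mul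
      (-(Complex.I * (⟪b, x⟫_ℝ : ℂ)))).cexp
    simp only [star_displacedFun_smul]
    convert! (hexp.mul_const (star (displacedFun s γ 0 x))).mul_const (f x) using 1
    simp only [Complex.ofRealCLM_apply, Complex.ofReal_one]
    ring

lemma inner_numberWave_smul (hs : 0 < s) (f : Wave M) (b : Config M) (r : ℝ) :
    ⟪numberWave hs γ (r • b), f⟫_ℂ =
      r * ((∫ x, -(Complex.I * (⟪b, x⟫_ℝ : ℂ)) * star (displacedFun s γ (r • b) x) * f x) +
        (s : ℂ) ^ 2 / 2 * (‖b‖ : ℂ) ^ 2 * r * ⟪displacedWave hs γ (r • b), f⟫_ℂ) := by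
  have hfactor : ∀ x, star (numberFactor s (r • b) x) = r * (-(Complex.I * (⟪b, x⟫_ℝ : ℂ)) +
      (s : ℂ) ^ 2 / 2 * (‖b‖ : ℂ) ^ 2 * r) := fun x => by
    have hsq : (‖r • b‖ : ℂ) ^ 2 = (r : ℂ) ^ 2 * (‖b‖ : ℂ) ^ 2 := by
      rw [norm_smul, Real.norm_eq_abs, ← Complex.ofReal_pow, mul_pow, sq_abs]
      push_cast
      rfl
    rw [star_numberFactor, real_inner_smul_left, hsq, Complex.ofReal_mul]
    ring
  rw [inner_numberWave, inner_displacedWave, ← integral_const_mul, ← integral_add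
      (integrable_mul_star_displacedFun_mul hs _ f (by fun_prop))
      ((integrable_star_displacedFun_mul hs (r • b) f).const_mul _),
    ← integral_const_mul]
  congr 1 with x
  rw [hfactor]
  ring

/-- Along the ray through `b` the overlap with the displaced states solves the differential
equation of a Gaussian. -/
lemma inner_displacedWave_mul_exp_eq (hs : 0 < s) {f : Wave M}
    (h : ∀ b, ⟪numberWave hs γ b, f⟫_ℂ = 0) (b : Config M) :
    ⟪displacedWave hs γ b, f⟫_ℂ * Real.exp (s ^ 2 * ‖b‖ ^ 2 / 4) = ⟪cubic s hs γ M, f⟫_ℂ := by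
  set F : ℝ → ℂ := fun r => ⟪displacedWave hs γ (r • b), f⟫_ℂ with hF
  set G : ℝ → ℂ := fun r => F r * Real.exp (s ^ 2 * ‖b‖ ^ 2 * r ^ 2 / 4) with hG
  have hF' : ∀ r ≠ 0, HasDerivAt F (-((s : ℂ) ^ 2 / 2 * (‖b‖ : ℂ) ^ 2 * r * F r)) r :=
    fun r hr => by
      have hode := inner_numberWave_smul (γ := γ) hs f b r
      rw [h, eq_comm] at hode
      rw [← eq_neg_of_add_eq_zero_left
        ((mul_eq_zero.1 hode).resolve_left (Complex.ofReal_ne_zero.2 hr))]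
      exact hasDerivAt_inner_displacedWave_smul hs f b r
  have hG' : ∀ r ≠ 0, HasDerivAt G 0 r := fun r hr => by
    have hexp := ((((hasDerivAt_id r).pow 2).const_mul (s ^ 2 * ‖b‖ ^ 2)).div_const 4).exp
    convert! (hF' r hr).mul hexp.ofReal_comp using 1
    simp
    ring
  have hG_cont : Continuous G := by
    have hF_cont : Continuous F := continuous_iff_continuousAt.2 fun r =>
      (hasDerivAt_inner_displacedWave_smul hs f b r).continuousAt
    fun_prop
  have hconst := constant_of_has_deriv_right_zero (f := fun t => G (1 - t)) (a := 0) (b := 1)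
    (by fun_prop) (fun t ht => ((hG' (1 - t) (sub_pos.2 ht.2).ne').comp_const_sub 1
      t).hasDerivWithinAt.congr_deriv (by simp)) 1 (Set.right_mem_Icc.2 zero_le_one)
  simpa [hG, hF, displacedWave_zero] using hconst.symm

lemma inner_numberWave_sub_inner_smul_cubic (hs : 0 < s) (f : Wave M) (b : Config M) :
    ⟪numberWave hs γ b, f - ⟪cubic s hs γ M, f⟫_ℂ • cubic s hs γ M⟫_ℂ =
      ⟪numberWave hs γ b, f⟫_ℂ := by
  rw [inner_sub_right, inner_smul_right, inner_numberWave_cubic, mul_zero, sub_zero]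

lemma inner_cubic_sub_inner_smul_cubic (hs : 0 < s) (f : Wave M) :
    ⟪cubic s hs γ M, f - ⟪cubic s hs γ M, f⟫_ℂ • cubic s hs γ M⟫_ℂ = 0 := by
  rw [inner_sub_right, inner_smul_right, inner_self_eq_norm_sq_to_K, norm_cubic hs]
  simp

lemma eq_inner_smul_cubic_of_forall_inner_numberWave_eq_zero (hs : 0 < s) {g : Wave M}
    (h : ∀ b, ⟪numberWave hs γ b, g⟫_ℂ = 0) : g = ⟪cubic s hs γ M, g⟫_ℂ • cubic s hs γ M := by
  refine sub_eq_zero.1 (eq_zero_of_forall_inner_displacedWave_eq_zero (γ := γ) hs fun b => ?_)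
  have hexp := inner_displacedWave_mul_exp_eq hs
    (fun b => (inner_numberWave_sub_inner_smul_cubic hs g b).trans (h b)) b
  rw [inner_cubic_sub_inner_smul_cubic] at hexp
  exact (mul_eq_zero.1 hexp).resolve_right (Complex.ofReal_ne_zero.2 (Real.exp_pos _).ne')

lemma sub_inner_smul_cubic_mem_closure_span_numberWave (hs : 0 < s) (f : Wave M) :
    f - ⟪cubic s hs γ M, f⟫_ℂ • cubic s hs γ M ∈
      (Submodule.span ℂ (Set.range (numberWave (M := M) hs γ))).topologicalClosure := by
  rw [← Submodule.orthogonal_orthogonal_eq_closure, Submodule.mem_orthogonal]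
  intro g hg
  rw [eq_inner_smul_cubic_of_forall_inner_numberWave_eq_zero (γ := γ) hs fun b =>
      (Submodule.mem_orthogonal _ _).1 hg _ (Submodule.subset_span ⟨b, rfl⟩),
    inner_smul_left, inner_cubic_sub_inner_smul_cubic, mul_zero]

/-- The spectral gap of the number operator: it dominates the projection onto the orthogonal
complement of the cubic phase state. -/
theorem norm_sq_sub_norm_inner_cubic_sq_le (hs : 0 < s) {f : Wave M} {B : Fin M → Wave M}
    (h : ∀ k, IsLowered s γ k f (B k)) :
    ‖f‖ ^ 2 - ‖⟪cubic s hs γ M, f⟫_ℂ‖ ^ 2 ≤ s ^ 2 / 2 * ∑ k, ‖B k‖ ^ 2 := by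
  have hle := norm_le_of_mem_closure_span
    (norm_linearCombination_le_of_inner_eq_add (inner_numberWave_numberWave (γ := γ) hs))
    (y := WithLp.toLp 2 fun k => ((s / Real.sqrt 2 : ℝ) : ℂ) • B k)
    (fun b => (inner_numberWave_sub_inner_smul_cubic hs f b).trans
      (inner_numberWave_eq_inner_loweredWave hs h b))
    (sub_inner_smul_cubic_mem_closure_span_numberWave hs f)
  rw [← norm_sub_inner_smul_sq (norm_cubic hs)]
  refine (pow_le_pow_left₀ (norm_nonneg _) hle 2).trans_eq ?_
  rw [PiLp.norm_sq_eq_of_L2, Finset.mul_sum]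
  refine Finset.sum_congr rfl fun k _ => ?_
  rw [PiLp.toLp_apply, norm_smul, Complex.norm_real, Real.norm_eq_abs, mul_pow, sq_abs, div_pow,
    Real.sq_sqrt two_pos.le]

end Totality

/-! ### Moments of homodyne outcomes -/

section Born

variable {M : ℕ} {φ : Wave M} {q : Config M → ℝ}

lemma measurable_density (φ : Wave M) : Measurable fun x => ENNReal.ofReal (‖φ x‖ ^ 2) :=
  ((Lp.stronglyMeasurable φ).measurable.norm.pow_const 2).ennreal_ofReal

lemma lintegral_map_bornMeasure (φ : Wave M) (hq : Measurable q) {h : ℝ → ℝ≥0∞}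
    (hh : Measurable h) :
    ∫⁻ v, h v ∂((bornMeasure φ).map q) = ∫⁻ x, ENNReal.ofReal (‖φ x‖ ^ 2) * h (q x) := by
  rw [lintegral_map hh hq, bornMeasure]
  exact lintegral_withDensity_eq_lintegral_mul _ (measurable_density φ) (hh.comp hq)

lemma integral_map_bornMeasure (φ : Wave M) (hq : Measurable q) {h : ℝ → ℝ} (hh : Measurable h) :
    ∫ v, h v ∂((bornMeasure φ).map q) = ∫ x, ‖φ x‖ ^ 2 * h (q x) := by
  rw [integral_map hq.aemeasurable hh.aestronglyMeasurable, bornMeasure,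
    integral_withDensity_eq_integral_toReal_smul (measurable_density φ)
      (Filter.Eventually.of_forall fun _ => ENNReal.ofReal_lt_top)]
  exact integral_congr_ae (Filter.Eventually.of_forall fun x =>
    congrArg (· * h (q x)) (ENNReal.toReal_ofReal (by positivity)))

lemma memLp_pow_mul_of_lintegral_map_bornMeasure_lt_top (hq : Measurable q) {n : ℕ}
    (h : ∫⁻ v, ENNReal.ofReal ((v ^ n) ^ 2) ∂((bornMeasure φ).map q) < ⊤) :
    MemLp (fun x => (q x : ℂ) ^ n * φ x) 2 := by
  rw [lintegral_map_bornMeasure φ hq (by fun_prop)] at h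
  have hmeas : AEStronglyMeasurable (fun x => (q x : ℂ) ^ n * φ x) volume :=
    ((Complex.measurable_ofReal.comp hq).pow_const n).aestronglyMeasurable.mul
      (Lp.aestronglyMeasurable φ)
  rw [memLp_two_iff_integrable_sq_norm hmeas]
  refine ⟨hmeas.norm.pow 2, ?_⟩
  rw [hasFiniteIntegral_iff_ofReal (Filter.Eventually.of_forall fun x => by positivity)]
  refine (lintegral_congr fun x => ?_).trans_lt h
  rw [← ENNReal.ofReal_mul (by positivity), norm_mul, norm_pow, Complex.norm_real,
    Real.norm_eq_abs, mul_pow, pow_right_comm, sq_abs, pow_right_comm, mul_comm]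

lemma memLp_pow_mul_of_le (hq : Measurable q) {n j : ℕ} (hj : j ≤ n)
    (h : MemLp (fun x => (q x : ℂ) ^ n * φ x) 2) : MemLp (fun x => (q x : ℂ) ^ j * φ x) 2 := by
  have hmeas : AEStronglyMeasurable (fun x => (q x : ℂ) ^ j * φ x) volume :=
    ((Complex.measurable_ofReal.comp hq).pow_const j).aestronglyMeasurable.mul
      (Lp.aestronglyMeasurable φ)
  refine MemLp.mono (g := fun x => ‖φ x‖ + ‖(q x : ℂ) ^ n * φ x‖)
    ((Lp.memLp φ).norm.add h.norm) hmeas (Filter.Eventually.of_forall fun x => ?_)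
  rw [Real.norm_of_nonneg (by positivity), norm_mul, norm_mul, norm_pow, norm_pow]
  have hle : ‖(q x : ℂ)‖ ^ j ≤ 1 + ‖(q x : ℂ)‖ ^ n := by
    rcases le_total ‖(q x : ℂ)‖ 1 with h1 | h1
    · exact (pow_le_one₀ (norm_nonneg _) h1).trans (le_add_of_nonneg_right (by positivity))
    · exact (pow_le_pow_right₀ h1 hj).trans (le_add_of_nonneg_left zero_le_one)
  calc ‖(q x : ℂ)‖ ^ j * ‖φ x‖ ≤ (1 + ‖(q x : ℂ)‖ ^ n) * ‖φ x‖ := by gcongr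
    _ = _ := by ring

end Born

section Momentum

variable {M : ℕ} {k : Fin M} {φ d₁ d₂ : Wave M}

lemma hasFourierDeriv_axis_iff : HasFourierDeriv (axis k) φ d₁ ↔
    (𝓕 d₁ : Wave M) =ᵐ[volume] fun ξ =>
      Complex.I * (((2 * Real.pi * ξ k : ℝ) : ℂ) * (𝓕 φ : Wave M) ξ) := by
  refine Filter.EventuallyEq.congr_right (Filter.Eventually.of_forall fun ξ => ?_)
  simp only [axis, EuclideanSpace.inner_single_right, one_mul, conj_trivial]
  push_cast
  ring

lemma exists_hasFourierDeriv_axis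
    (h : MemLp (fun ξ => ((2 * Real.pi * ξ k : ℝ) : ℂ) * (𝓕 φ : Wave M) ξ) 2) :
    ∃ d : Wave M, HasFourierDeriv (axis k) φ d := by
  have hI := h.const_mul Complex.I
  refine ⟨𝓕⁻ (hI.toLp _), hasFourierDeriv_axis_iff.2 ?_⟩
  rw [show 𝓕 (𝓕⁻ (hI.toLp _) : Wave M) = hI.toLp _ from FourierTransform.fourier_fourierInv_eq _]
  exact hI.coeFn_toLp

lemma exists_hasFourierDeriv_hasFourierDeriv_axis
    (h : MemLp (fun ξ => ((2 * Real.pi * ξ k : ℝ) : ℂ) ^ 3 * (𝓕 φ : Wave M) ξ) 2) :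
    ∃ d₁ d₂ : Wave M, HasFourierDeriv (axis k) φ d₁ ∧ HasFourierDeriv (axis k) d₁ d₂ := by
  have hq : Measurable fun ξ : Config M => 2 * Real.pi * ξ k := by fun_prop
  obtain ⟨d₁, hd₁⟩ := exists_hasFourierDeriv_axis
    (by simpa only [pow_one] using memLp_pow_mul_of_le hq (j := 1) (by norm_num) h)
  have hsq := (memLp_pow_mul_of_le hq (j := 2) (by norm_num) h).const_mul Complex.I
  obtain ⟨d₂, hd₂⟩ := exists_hasFourierDeriv_axis (φ := d₁) <| hsq.ae_eq <| by
    filter_upwards [hasFourierDeriv_axis_iff.1 hd₁] with ξ hξ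
    rw [hξ]
    ring
  exact ⟨d₁, d₂, hd₁, hd₂⟩

namespace HasFourierDeriv

lemma integral_norm_fourier_sq_mul_sq (h : HasFourierDeriv (axis k) φ d₁) :
    ∫ ξ, ‖(𝓕 φ : Wave M) ξ‖ ^ 2 * (2 * Real.pi * ξ k) ^ 2 = ‖d₁‖ ^ 2 := by
  rw [← Lp.norm_fourier_eq d₁, norm_sq_eq_integral_of_ae_eq (hasFourierDeriv_axis_iff.1 h)]
  refine integral_congr_ae (Filter.Eventually.of_forall fun ξ => ?_)
  simp only [norm_mul, Complex.norm_I, one_mul, Complex.norm_real, Real.norm_eq_abs, mul_pow,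
    sq_abs]
  ring

lemma integral_norm_fourier_sq_mul_cube (h : HasFourierDeriv (axis k) φ d₁)
    (h' : HasFourierDeriv (axis k) d₁ d₂) :
    ((∫ ξ, ‖(𝓕 φ : Wave M) ξ‖ ^ 2 * (2 * Real.pi * ξ k) ^ 3 : ℝ) : ℂ) * Complex.I =
      ⟪d₁, d₂⟫_ℂ := by
  have hd₁ := hasFourierDeriv_axis_iff.1 h
  rw [← Lp.inner_fourier_eq,
    inner_eq_integral_of_ae_eq hd₁ (hasFourierDeriv_axis_iff.1 h'), ← integral_complex_ofReal,
    ← integral_mul_const]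
  refine integral_congr_ae ?_
  filter_upwards [hd₁] with ξ hξ
  simp only [hξ, star_mul', Complex.star_def, Complex.conj_I, Complex.conj_ofReal,
    Complex.ofReal_mul, Complex.ofReal_pow, ← Complex.conj_mul']
  linear_combination (Complex.I * ((2 : ℝ) * Real.pi * ξ k) ^ 3 *
    (starRingEnd ℂ) ((𝓕 φ : Wave M) ξ) * (𝓕 φ : Wave M) ξ) * Complex.I_sq

end HasFourierDeriv

end Momentum

/-! ### The witness on a single vector -/

section Chirp

variable {M : ℕ} {k : Fin M} {c : ℝ}

/-- The phase function by which `chirp k c` multiplies. -/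
def chirpFun (k : Fin M) (c : ℝ) (x : Config M) : ℂ :=
  Complex.exp (Complex.I * ((c * x k ^ 2 / 2 : ℝ) : ℂ))

lemma coeFn_chirp (k : Fin M) (c : ℝ) (φ : Wave M) :
    chirp k c φ =ᵐ[volume] fun x => chirpFun k c x * φ x := coeFn_phase _ φ

lemma inner_chirp (k : Fin M) (c : ℝ) (φ ψ : Wave M) :
    ⟪chirp k c φ, chirp k c ψ⟫_ℂ = ⟪φ, ψ⟫_ℂ :=
  (phaseₗᵢ (fun x : Config M => c * x k ^ 2 / 2) (by fun_prop)).inner_map_map φ ψ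

lemma chirp_zero (k : Fin M) (φ : Wave M) : chirp k 0 φ = φ := by
  refine Lp.ext ?_
  filter_upwards [coeFn_chirp k 0 φ] with x hx
  simp [hx, chirpFun]

lemma chirpFun_neg_mul (k : Fin M) (c : ℝ) (x : Config M) :
    chirpFun k (-c) x * chirpFun k c x = 1 := by
  rw [chirpFun, chirpFun, ← Complex.exp_add, ← Complex.exp_zero]
  congr 1
  push_cast
  ring

lemma contDiff_chirpFun (k : Fin M) (c : ℝ) : ContDiff ℝ ∞ (chirpFun k c) := by
  have h : ContDiff ℝ ∞ fun x : Config M => Complex.I * (c * (x k : ℂ) ^ 2 / 2) :=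
    contDiff_const.mul ((contDiff_const.mul ((contDiff_apply_ofReal k).pow 2)).div_const 2)
  convert! h.cexp using 2
  simp [chirpFun]

lemma fderiv_chirpFun_axis (k : Fin M) (c : ℝ) (x : Config M) :
    fderiv ℝ (chirpFun k c) x (axis k) = chirpFun k c x * (Complex.I * c * x k) := by
  have hsq : HasDerivAt (fun t : ℝ => c * t ^ 2 / 2) (c * x k) (x k) := by
    convert! (((hasDerivAt_id (x k)).pow 2).const_mul c).div_const 2 using 1
    simp
    ring
  have hexp : HasDerivAt (fun t : ℝ => Complex.exp (Complex.I * ((c * t ^ 2 / 2 : ℝ) : ℂ)))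
      (chirpFun k c x * (Complex.I * c * x k)) (x k) := by
    convert! (hsq.ofReal_comp.const_mul Complex.I).cexp using 1
    push_cast [chirpFun]
    ring
  exact fderiv_comp_apply_axis hexp

lemma HasWeakDeriv.chirpFun_mul {f u : Config M → ℂ} (h : HasWeakDeriv (axis k) f u) (c : ℝ) :
    HasWeakDeriv (axis k) (fun x => chirpFun k c x * f x)
      (fun x => chirpFun k c x * (u x + Complex.I * c * (x k * f x))) := by
  refine (h.mul_left (contDiff_chirpFun k c)).congr .rfl (Filter.Eventually.of_forall fun x => ?_)
  simp only [fderiv_chirpFun_axis]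
  ring

lemma HasWeakDeriv.const_mul_apply_mul {f u : Config M → ℂ} (h : HasWeakDeriv (axis k) f u)
    (a : ℂ) : HasWeakDeriv (axis k) (fun x => a * (x k * f x))
      (fun x => a * (x k * u x + f x)) := by
  have hderiv : ∀ x : Config M, fderiv ℝ (fun x : Config M => a * (x k : ℂ)) x (axis k) = a :=
    fun x => fderiv_comp_apply_axis <| by
      simpa using (Complex.ofRealCLM.hasDerivAt (x := x k)).const_mul a
  refine (h.mul_left (contDiff_const.mul (contDiff_apply_ofReal k) (f := fun _ => a))).congr
    (Filter.Eventually.of_forall fun x => mul_assoc _ _ _)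
    (Filter.Eventually.of_forall fun x => ?_)
  simp only [hderiv]
  ring

lemma ae_eq_of_hasWeakDeriv_chirp {φ d₁ e₁ : Wave M} (h : HasWeakDeriv (axis k) φ d₁)
    (h' : HasWeakDeriv (axis k) (chirp k c φ) e₁) :
    e₁ =ᵐ[volume] fun x => chirpFun k c x * (d₁ x + Complex.I * c * (x k * φ x)) :=
  h'.unique ((h.chirpFun_mul c).congr (coeFn_chirp k c φ).symm .rfl)

lemma ae_eq_of_hasWeakDeriv_hasWeakDeriv_chirp {φ d₁ d₂ e₁ e₂ : Wave M}
    (h₁ : HasWeakDeriv (axis k) φ d₁) (h₂ : HasWeakDeriv (axis k) d₁ d₂)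
    (h₁' : HasWeakDeriv (axis k) (chirp k c φ) e₁) (h₂' : HasWeakDeriv (axis k) e₁ e₂) :
    e₂ =ᵐ[volume] fun x => chirpFun k c x *
      (d₂ x + Complex.I * c * (2 * (x k * d₁ x) + φ x) - c ^ 2 * (x k * (x k * φ x))) := by
  have h := (h₂.add (h₁.const_mul_apply_mul (Complex.I * c))).chirpFun_mul c
  filter_upwards [h₂'.unique (h.congr (ae_eq_of_hasWeakDeriv_chirp h₁ h₁').symm .rfl)] with x hx
  rw [hx]
  linear_combination (chirpFun k c x * c ^ 2 * x k ^ 2 * φ x) * Complex.I_sq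

end Chirp

lemma inner_eq_inner_of_ae_eq_ofReal_mul {X : Type*} [MeasurableSpace X] {μ : Measure X}
    {q : X → ℝ} {u u' v v' : Lp ℂ 2 μ} (hu : u' =ᵐ[μ] fun x => (q x : ℂ) * u x)
    (hv : v' =ᵐ[μ] fun x => (q x : ℂ) * v x) : ⟪u', v⟫_ℂ = ⟪u, v'⟫_ℂ := by
  rw [inner_eq_integral_of_ae_eq hu (v := v) .rfl, inner_eq_integral_of_ae_eq (u := u) .rfl hv]
  refine integral_congr_ae (Filter.Eventually.of_forall fun x => ?_)
  simp only [star_mul', Complex.star_def, Complex.conj_ofReal]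
  ring

/-- The third power of the quadrature `p̂ₖ + c x̂ₖ` has finite second moment in `φ`. -/
def HasCubicMomentum {M : ℕ} (k : Fin M) (c : ℝ) (φ : Wave M) : Prop :=
  MemLp (fun ξ => ((2 * Real.pi * ξ k : ℝ) : ℂ) ^ 3 * (𝓕 (chirp k c φ) : Wave M) ξ) 2

/-- The expectation of `(p̂ₖ + c x̂ₖ)³` in `φ`. -/
def thirdMoment {M : ℕ} (k : Fin M) (c : ℝ) (φ : Wave M) : ℝ :=
  ∫ ξ, ‖(𝓕 (chirp k c φ) : Wave M) ξ‖ ^ 2 * (2 * Real.pi * ξ k) ^ 3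

/-- The vectors `x₁, x₂, d₁, d₂, y` are `xₖ φ, xₖ² φ, ∂ₖ φ, ∂ₖ² φ, xₖ ∂ₖ φ`, all of them
square-integrable: every expectation in the witness is an inner product of two of them. -/
structure IsModeJet {M : ℕ} (k : Fin M) (φ x₁ x₂ d₁ d₂ y : Wave M) : Prop where
  mul : x₁ =ᵐ[volume] fun x => (x k : ℂ) * φ x
  mul_mul : x₂ =ᵐ[volume] fun x => (x k : ℂ) * x₁ x
  deriv : HasFourierDeriv (axis k) φ d₁
  deriv_deriv : HasFourierDeriv (axis k) d₁ d₂
  mul_deriv : y =ᵐ[volume] fun x => (x k : ℂ) * d₁ x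

section Jet

variable {M : ℕ} {k : Fin M} {φ x₁ x₂ d₁ d₂ y : Wave M} {c : ℝ}

/-- The second derivative of the chirped vector contains `xₖ ∂ₖ φ`, and all its other terms are
square-integrable. -/
lemma memLp_apply_mul_of_hasCubicMomentum_one
    (hx : MemLp (fun x => ((x k : ℝ) : ℂ) ^ 2 * φ x) 2) (hp : HasCubicMomentum k 1 φ)
    (h₁ : HasWeakDeriv (axis k) φ d₁) (h₂ : HasWeakDeriv (axis k) d₁ d₂) :
    MemLp (fun x => ((x k : ℝ) : ℂ) * d₁ x) 2 := by
  obtain ⟨e₁, e₂, he₁, he₂⟩ := exists_hasFourierDeriv_hasFourierDeriv_axis hp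
  have he := ae_eq_of_hasWeakDeriv_hasWeakDeriv_chirp h₁ h₂ he₁.hasWeakDeriv he₂.hasWeakDeriv
  refine ((((Lp.memLp (chirp k (-1) e₂)).sub (Lp.memLp d₂)).sub
    ((Lp.memLp φ).const_mul Complex.I)).add hx).const_mul (-Complex.I / 2) |>.ae_eq ?_
  filter_upwards [he, coeFn_chirp k (-1) e₂] with x hx hx'
  simp only [Pi.add_apply, Pi.sub_apply]
  rw [hx', hx, ← mul_assoc (chirpFun k (-1) x), chirpFun_neg_mul, Complex.ofReal_one]
  linear_combination (-(x k : ℂ) * d₁ x) * Complex.I_sq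

lemma exists_isModeJet (hx : MemLp (fun x => ((x k : ℝ) : ℂ) ^ 2 * φ x) 2)
    (h₀ : HasCubicMomentum k 0 φ) (h₁ : HasCubicMomentum k 1 φ) :
    ∃ x₁ x₂ d₁ d₂ y : Wave M, IsModeJet k φ x₁ x₂ d₁ d₂ y := by
  rw [HasCubicMomentum, chirp_zero] at h₀
  obtain ⟨d₁, d₂, hd₁, hd₂⟩ := exists_hasFourierDeriv_hasFourierDeriv_axis h₀
  have hx₁ : MemLp (fun x => ((x k : ℝ) : ℂ) ^ 1 * φ x) 2 :=
    memLp_pow_mul_of_le (by fun_prop) one_le_two hx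
  have hy := memLp_apply_mul_of_hasCubicMomentum_one hx h₁ hd₁.hasWeakDeriv hd₂.hasWeakDeriv
  refine ⟨hx₁.toLp _, hx.toLp _, d₁, d₂, hy.toLp _, ?_, ?_, hd₁, hd₂, hy.coeFn_toLp⟩
  · simpa only [pow_one] using hx₁.coeFn_toLp
  · filter_upwards [hx.coeFn_toLp, hx₁.coeFn_toLp] with x hx hx'
    rw [hx, hx']
    ring

namespace IsModeJet

variable (J : IsModeJet k φ x₁ x₂ d₁ d₂ y)
include J

lemma hasFourierDeriv_chirp (h : HasCubicMomentum k c φ) :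
    HasFourierDeriv (axis k) (chirp k c φ) (chirp k c (d₁ + (Complex.I * c) • x₁)) ∧
    HasFourierDeriv (axis k) (chirp k c (d₁ + (Complex.I * c) • x₁))
      (chirp k c (d₂ + (Complex.I * c) • ((2 : ℂ) • y + φ) - (c ^ 2 : ℂ) • x₂)) := by
  obtain ⟨e₁, e₂, he₁, he₂⟩ := exists_hasFourierDeriv_hasFourierDeriv_axis h
  have hw := J.deriv.hasWeakDeriv
  have heq₁ : e₁ = chirp k c (d₁ + (Complex.I * c) • x₁) := by
    refine Lp.ext ?_
    filter_upwards [ae_eq_of_hasWeakDeriv_chirp hw he₁.hasWeakDeriv, J.mul,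
      coeFn_chirp k c (d₁ + (Complex.I * c) • x₁), Lp.coeFn_add d₁ ((Complex.I * c) • x₁),
      Lp.coeFn_smul (Complex.I * c) x₁] with x he hx₁ hchirp hadd hsmul
    simp only [he, hchirp, hadd, hsmul, hx₁, Pi.add_apply, Pi.smul_apply, smul_eq_mul]
  have heq₂ : e₂ = chirp k c (d₂ + (Complex.I * c) • ((2 : ℂ) • y + φ) - (c ^ 2 : ℂ) • x₂) := by
    refine Lp.ext ?_
    filter_upwards [ae_eq_of_hasWeakDeriv_hasWeakDeriv_chirp hw J.deriv_deriv.hasWeakDeriv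
        he₁.hasWeakDeriv he₂.hasWeakDeriv, J.mul, J.mul_mul, J.mul_deriv,
      coeFn_chirp k c (d₂ + (Complex.I * c) • ((2 : ℂ) • y + φ) - (c ^ 2 : ℂ) • x₂),
      Lp.coeFn_sub (d₂ + (Complex.I * c) • ((2 : ℂ) • y + φ)) ((c ^ 2 : ℂ) • x₂),
      Lp.coeFn_add d₂ ((Complex.I * c) • ((2 : ℂ) • y + φ)),
      Lp.coeFn_smul (Complex.I * c) ((2 : ℂ) • y + φ), Lp.coeFn_add ((2 : ℂ) • y) φ,
      Lp.coeFn_smul (2 : ℂ) y, Lp.coeFn_smul (c ^ 2 : ℂ) x₂]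
      with x he hx₁ hx₂ hy hchirp hsub hadd hsmul hadd' hsmul' hsmul''
    simp only [he, hchirp, hsub, hadd, hsmul, hadd', hsmul', hsmul'', hx₂, hx₁, hy, Pi.sub_apply,
      Pi.add_apply, Pi.smul_apply, smul_eq_mul]
  exact ⟨heq₁ ▸ he₁, heq₁ ▸ heq₂ ▸ he₂⟩

lemma thirdMoment_mul_I (h : HasCubicMomentum k c φ) :
    (thirdMoment k c φ : ℂ) * Complex.I = ⟪d₁ + (Complex.I * c) • x₁,
      d₂ + (Complex.I * c) • ((2 : ℂ) • y + φ) - (c ^ 2 : ℂ) • x₂⟫_ℂ := by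
  obtain ⟨h₁, h₂⟩ := J.hasFourierDeriv_chirp h
  rw [← inner_chirp k c]
  exact h₁.integral_norm_fourier_sq_mul_cube h₂

/-- The canonical commutation relation, in the form `∂* x + x ∂ = -1`. -/
lemma inner_deriv_mul_add (h : HasCubicMomentum k 1 φ) :
    ⟪d₁, x₁⟫_ℂ + ⟪x₁, d₁⟫_ℂ = -⟪φ, φ⟫_ℂ := by
  obtain ⟨h₁, h₂⟩ := J.hasFourierDeriv_chirp h
  have hchirp := h₁.inner_eq_neg_inner h₂
  have hφ := J.deriv.inner_eq_neg_inner J.deriv_deriv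
  have hy : ⟪x₁, d₁⟫_ℂ = ⟪φ, y⟫_ℂ := inner_eq_inner_of_ae_eq_ofReal_mul J.mul J.mul_deriv
  have hx : ⟪x₁, x₁⟫_ℂ = ⟪φ, x₂⟫_ℂ := inner_eq_inner_of_ae_eq_ofReal_mul J.mul J.mul_mul
  simp only [inner_chirp, inner_add_left, inner_add_right, inner_sub_right, inner_smul_left,
    inner_smul_right, map_mul, map_one, Complex.conj_I, Complex.ofReal_one, ← hy, ← hx, hφ]
    at hchirp
  linear_combination (-Complex.I) * hchirp +
    (⟪d₁, x₁⟫_ℂ + ⟪x₁, d₁⟫_ℂ + ⟪φ, φ⟫_ℂ - Complex.I * ⟪x₁, x₁⟫_ℂ) * Complex.I_sq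

lemma two_mul_re_inner_deriv_mul (h : HasCubicMomentum k 1 φ) :
    2 * (⟪d₁, x₁⟫_ℂ).re = -‖φ‖ ^ 2 := by
  have hre := congrArg Complex.re (J.inner_deriv_mul_add h)
  rw [Complex.add_re, Complex.neg_re, ← inner_conj_symm x₁, Complex.conj_re] at hre
  have hφ : (⟪φ, φ⟫_ℂ).re = ‖φ‖ ^ 2 := inner_self_eq_norm_sq (𝕜 := ℂ) φ
  linarith

lemma im_inner_mul_mul_mul : (⟪x₁, x₂⟫_ℂ).im = 0 := by
  rw [← Complex.conj_eq_iff_im, inner_conj_symm]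
  exact inner_eq_inner_of_ae_eq_ofReal_mul J.mul_mul J.mul_mul

/-- The second difference in `c` of the third moment of `p̂ + c x̂` is twice the expectation of the
symmetrization of `p̂ x̂²`. -/
lemma thirdMoment_second_difference (h₀ : HasCubicMomentum k 0 φ) (h₁ : HasCubicMomentum k 1 φ)
    (h₂ : HasCubicMomentum k (-1) φ) :
    thirdMoment k 1 φ + thirdMoment k (-1) φ - 2 * thirdMoment k 0 φ =
      -6 * (⟪d₁, x₂⟫_ℂ).im := by
  have hy : ⟪x₂, d₁⟫_ℂ = ⟪x₁, y⟫_ℂ := inner_eq_inner_of_ae_eq_ofReal_mul J.mul_mul J.mul_deriv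
  have hx : (⟪x₁, φ⟫_ℂ).im = 0 := by
    rw [← Complex.conj_eq_iff_im, inner_conj_symm]
    exact (inner_eq_inner_of_ae_eq_ofReal_mul J.mul J.mul).symm
  have him : (⟪x₂, d₁⟫_ℂ).im = -(⟪d₁, x₂⟫_ℂ).im := by
    rw [← inner_conj_symm x₂, Complex.conj_im]
  have hdiff : ((thirdMoment k 1 φ + thirdMoment k (-1) φ - 2 * thirdMoment k 0 φ : ℝ) : ℂ) *
      Complex.I = 4 * ⟪x₂, d₁⟫_ℂ - 2 * ⟪d₁, x₂⟫_ℂ + 2 * ⟪x₁, φ⟫_ℂ := by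
    push_cast
    rw [sub_mul, add_mul, mul_assoc 2, J.thirdMoment_mul_I h₀, J.thirdMoment_mul_I h₁,
      J.thirdMoment_mul_I h₂]
    simp only [inner_add_left, inner_add_right, inner_sub_right, inner_smul_left,
      inner_smul_right, map_mul, map_neg, map_zero, map_one, Complex.conj_I, Complex.ofReal_zero,
      Complex.ofReal_one, Complex.ofReal_neg, ← hy]
    linear_combination (-4 * ⟪x₂, d₁⟫_ℂ - 2 * ⟪x₁, φ⟫_ℂ) * Complex.I_sq
  have := congrArg Complex.im hdiff
  simp only [Complex.mul_im, Complex.ofReal_re, Complex.ofReal_im, Complex.I_re, Complex.I_im,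
    Complex.add_im, Complex.sub_im, Complex.re_ofNat, Complex.im_ofNat, hx, him] at this
  linarith

lemma isLowered (s γ : ℝ) :
    IsLowered s γ k φ (d₁ + ((s ^ 2)⁻¹ : ℂ) • x₁ - (3 * Complex.I * γ) • x₂) := by
  refine ⟨d₁, J.deriv.hasWeakDeriv, ?_⟩
  filter_upwards [J.mul, J.mul_mul,
    Lp.coeFn_sub (d₁ + ((s ^ 2)⁻¹ : ℂ) • x₁) ((3 * Complex.I * γ) • x₂),
    Lp.coeFn_add d₁ (((s ^ 2)⁻¹ : ℂ) • x₁), Lp.coeFn_smul ((s ^ 2)⁻¹ : ℂ) x₁,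
    Lp.coeFn_smul (3 * Complex.I * γ) x₂] with x hx₁ hx₂ hsub hadd hsmul hsmul'
  simp only [hsub, hadd, hsmul, hsmul', hx₂, hx₁, Pi.sub_apply, Pi.add_apply, Pi.smul_apply,
    smul_eq_mul, lowerCoeff]
  ring

lemma norm_lowered_sq {s : ℝ} (hs : 0 < s) (γ : ℝ) (h : HasCubicMomentum k 1 φ) :
    s ^ 2 * ‖d₁ + ((s ^ 2)⁻¹ : ℂ) • x₁ - (3 * Complex.I * γ) • x₂‖ ^ 2 =
      s ^ 2 * ‖d₁‖ ^ 2 + ‖x₁‖ ^ 2 / s ^ 2 + 9 * γ ^ 2 * s ^ 2 * ‖x₂‖ ^ 2 - ‖φ‖ ^ 2 +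
        6 * γ * s ^ 2 * (⟪d₁, x₂⟫_ℂ).im := by
  have hsq : ((s : ℂ) ^ 2)⁻¹ = (((s ^ 2)⁻¹ : ℝ) : ℂ) := by push_cast; rfl
  have hd : 2 * (⟪d₁, ((s ^ 2)⁻¹ : ℂ) • x₁⟫_ℂ).re = -‖φ‖ ^ 2 / s ^ 2 := by
    rw [hsq, inner_smul_right, Complex.re_ofReal_mul]
    linear_combination (s ^ 2)⁻¹ * J.two_mul_re_inner_deriv_mul h
  have hcross : (⟪d₁ + ((s ^ 2)⁻¹ : ℂ) • x₁, (3 * Complex.I * γ) • x₂⟫_ℂ).re =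
      -(3 * γ * (⟪d₁, x₂⟫_ℂ).im) := by
    rw [hsq, inner_smul_right, inner_add_left, inner_smul_left, Complex.conj_ofReal]
    simp only [Complex.mul_re, Complex.mul_im, Complex.add_re, Complex.add_im, Complex.re_ofNat,
      Complex.im_ofNat, Complex.I_re, Complex.I_im, Complex.ofReal_re, Complex.ofReal_im,
      J.im_inner_mul_mul_mul]
    ring
  have hx₁ : ‖((s ^ 2)⁻¹ : ℂ) • x₁‖ ^ 2 = ‖x₁‖ ^ 2 / s ^ 4 := by
    rw [hsq, norm_smul, Complex.norm_real, mul_pow, Real.norm_eq_abs, sq_abs]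
    field_simp
  have hx₂ : ‖(3 * Complex.I * γ) • x₂‖ ^ 2 = 9 * γ ^ 2 * ‖x₂‖ ^ 2 := by
    simp only [norm_smul, norm_mul, Complex.norm_ofNat, Complex.norm_I, Complex.norm_real,
      Real.norm_eq_abs, mul_pow, sq_abs]
    ring
  rw [norm_sub_sq (𝕜 := ℂ), norm_add_sq (𝕜 := ℂ)]
  simp only [RCLike.re_eq_complex_re, hd, hcross, hx₁, hx₂]
  field_simp
  ring

lemma integral_norm_sq_mul_sq : ∫ x, ‖φ x‖ ^ 2 * x k ^ 2 = ‖x₁‖ ^ 2 := by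
  rw [norm_sq_eq_integral_of_ae_eq J.mul]
  refine integral_congr_ae (Filter.Eventually.of_forall fun x => ?_)
  simp only [norm_mul, Complex.norm_real, Real.norm_eq_abs, mul_pow, sq_abs, mul_comm]

lemma integral_norm_sq_mul_fourth : ∫ x, ‖φ x‖ ^ 2 * x k ^ 4 = ‖x₂‖ ^ 2 := by
  rw [norm_sq_eq_integral_of_ae_eq J.mul_mul]
  refine integral_congr_ae ?_
  filter_upwards [J.mul] with x hx
  simp only [hx, norm_mul, Complex.norm_real, Real.norm_eq_abs, mul_pow, sq_abs]
  ring

end IsModeJet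

end Jet

section Witness

variable {M : ℕ} {k : Fin M} {φ : Wave M} {s : ℝ}

/-- The contribution `∑ₐ λₐ ⟨φ, fₐ φ⟩` of mode `k` to the expectation of the witness. -/
def modeWitness (s γ : ℝ) (k : Fin M) (φ : Wave M) : ℝ :=
  ∑ a, coeff s γ a * ∫ v, v ^ deg a ∂(vecHomodyne (quad a) k φ)

lemma modeWitness_eq (s γ : ℝ) (k : Fin M) (φ : Wave M) :
    modeWitness s γ k φ =
      -(1 / (2 * s ^ 2)) * (∫ x, ‖φ x‖ ^ 2 * x k ^ 2) +
        -(9 * γ ^ 2 * s ^ 2 / 2) * (∫ x, ‖φ x‖ ^ 2 * x k ^ 4) +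
        -(s ^ 2 / 2) * (∫ ξ, ‖(𝓕 φ : Wave M) ξ‖ ^ 2 * (2 * Real.pi * ξ k) ^ 2) +
        γ * s ^ 2 / 2 *
          (thirdMoment k 1 φ + thirdMoment k (-1) φ - 2 * thirdMoment k 0 φ) := by
  have hx : Measurable fun x : Config M => x k := by fun_prop
  have hp : Measurable fun ξ : Config M => 2 * Real.pi * ξ k := by fun_prop
  have hp' : Measurable fun ξ : Config M => -(2 * Real.pi * ξ k) := by fun_prop
  simp only [modeWitness, Fin.sum_univ_six, coeff, quad, deg, vecHomodyne, Matrix.cons_val]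
  rw [integral_map_bornMeasure _ hx (by fun_prop), integral_map_bornMeasure _ hx (by fun_prop),
    integral_map_bornMeasure _ hp (by fun_prop), integral_map_bornMeasure _ hp (by fun_prop),
    integral_map_bornMeasure _ hp' (by fun_prop), integral_map_bornMeasure _ hp (by fun_prop)]
  simp only [thirdMoment, chirp_zero, (Nat.odd_iff.2 rfl : Odd 3).neg_pow, mul_neg, integral_neg]
  ring

section FiniteMoments

variable (h : ∀ a, ∫⁻ v, ENNReal.ofReal ((v ^ deg a) ^ 2) ∂(vecHomodyne (quad a) k φ) < ⊤)
include h

lemma memLp_sq_mul_of_lintegral_vecHomodyne_lt_top :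
    MemLp (fun x => ((x k : ℝ) : ℂ) ^ 2 * φ x) 2 :=
  memLp_pow_mul_of_lintegral_map_bornMeasure_lt_top (by fun_prop) (h 0)

lemma hasCubicMomentum_zero_of_lintegral_vecHomodyne_lt_top : HasCubicMomentum k 0 φ := by
  rw [HasCubicMomentum, chirp_zero]
  exact memLp_pow_mul_of_lintegral_map_bornMeasure_lt_top (by fun_prop) (h 3)

lemma hasCubicMomentum_one_of_lintegral_vecHomodyne_lt_top : HasCubicMomentum k 1 φ :=
  memLp_pow_mul_of_lintegral_map_bornMeasure_lt_top (by fun_prop) (h 5)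

lemma hasCubicMomentum_neg_one_of_lintegral_vecHomodyne_lt_top : HasCubicMomentum k (-1) φ := by
  have hneg := (memLp_pow_mul_of_lintegral_map_bornMeasure_lt_top
    (q := fun ξ : Config M => -(2 * Real.pi * ξ k)) (by fun_prop) (h 4)).neg
  refine hneg.ae_eq (Filter.Eventually.of_forall fun ξ => ?_)
  simp only [Pi.neg_apply, deg, Matrix.cons_val]
  push_cast
  ring

/-- The single-mode part of the witness is `-(V n̂ V† + 1/2)`. -/
lemma exists_isLowered_modeWitness_eq (hs : 0 < s) (γ : ℝ) : ∃ B : Wave M, IsLowered s γ k φ B ∧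
    modeWitness s γ k φ = -(s ^ 2 / 2 * ‖B‖ ^ 2) - 1 / 2 * ‖φ‖ ^ 2 := by
  have h₀ := hasCubicMomentum_zero_of_lintegral_vecHomodyne_lt_top h
  have h₁ := hasCubicMomentum_one_of_lintegral_vecHomodyne_lt_top h
  have h₂ := hasCubicMomentum_neg_one_of_lintegral_vecHomodyne_lt_top h
  obtain ⟨x₁, x₂, d₁, d₂, y, J⟩ :=
    exists_isModeJet (memLp_sq_mul_of_lintegral_vecHomodyne_lt_top h) h₀ h₁
  refine ⟨_, J.isLowered s γ, ?_⟩
  rw [modeWitness_eq, J.integral_norm_sq_mul_sq, J.integral_norm_sq_mul_fourth,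
    J.deriv.integral_norm_fourier_sq_mul_sq, J.thirdMoment_second_difference h₀ h₁ h₂]
  linear_combination (1 / 2 : ℝ) * J.norm_lowered_sq hs γ h₁

end FiniteMoments

theorem add_sum_modeWitness_le_norm_inner_sq (hs : 0 < s) (γ : ℝ) (φ : Wave M)
    (h : ∀ (k : Fin M) (a : Fin 6),
      ∫⁻ v, ENNReal.ofReal ((v ^ deg a) ^ 2) ∂(vecHomodyne (quad a) k φ) < ⊤) :
    (1 + (M : ℝ) / 2) * ‖φ‖ ^ 2 + ∑ k, modeWitness s γ k φ ≤ ‖⟪cubic s hs γ M, φ⟫_ℂ‖ ^ 2 := by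
  choose B hB hBeq using fun k => exists_isLowered_modeWitness_eq (h k) hs γ
  have hgap := norm_sq_sub_norm_inner_cubic_sq_le hs hB
  simp only [hBeq, Finset.sum_sub_distrib, Finset.sum_neg_distrib, Finset.sum_const,
    Finset.card_univ, Fintype.card_fin, nsmul_eq_mul, ← Finset.mul_sum]
  linarith

end Witness

/-! ### Density operators and their homodyne laws -/

/-- The balls of radius `1/2` about the members of an orthonormal family are disjoint. -/
lemma countable_of_orthonormal {H : Type*} [NormedAddCommGroup H] [InnerProductSpace ℂ H]
    [TopologicalSpace.SeparableSpace H] {ι : Type*} {v : ι → H} (hv : Orthonormal ℂ v) :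
    Countable ι := by
  refine Pairwise.countable_of_isOpen_disjoint (s := fun i => Metric.ball (v i) (1 / 2))
    (fun i j hij => Metric.ball_disjoint_ball ?_) (fun i => Metric.isOpen_ball)
    (fun i => ⟨_, Metric.mem_ball_self one_half_pos⟩)
  have hdist : ‖v i - v j‖ ^ 2 = 2 := by
    rw [norm_sub_sq (𝕜 := ℂ), hv.1 i, hv.1 j, hv.2 hij]
    norm_num
  rw [dist_eq_norm]
  nlinarith [norm_nonneg (v i - v j)]

instance countable_basisIndex (M : ℕ) : Countable (basisIndex (Wave M)) :=
  have : Fact ((2 : ℝ≥0∞) ≠ ⊤) := ⟨ENNReal.ofNat_ne_top⟩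
  countable_of_orthonormal (basis (Wave M)).orthonormal

namespace DensityOperator

variable {H : Type*} [NormedAddCommGroup H] [InnerProductSpace ℂ H] [CompleteSpace H]
  (ρ : DensityOperator H)

lemma inner_op_basis (i : basisIndex H) :
    ⟪basis H i, ρ.op (basis H i)⟫_ℂ = ((‖ρ.vec i‖ ^ 2 : ℝ) : ℂ) := by
  have hsqrt : CFC.sqrt ρ.op * CFC.sqrt ρ.op = ρ.op :=
    CFC.sqrt_mul_sqrt_self ρ.op ((ContinuousLinearMap.nonneg_iff_isPositive _).2 ρ.isPositive)
  have hsymm : ⟪ρ.vec i, ρ.vec i⟫_ℂ = ⟪basis H i, CFC.sqrt ρ.op (ρ.vec i)⟫_ℂ :=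
    ((ContinuousLinearMap.nonneg_iff_isPositive _).1 (CFC.sqrt_nonneg ρ.op)).isSymmetric _ _
  calc ⟪basis H i, ρ.op (basis H i)⟫_ℂ = ⟪ρ.vec i, ρ.vec i⟫_ℂ := by
        rw [hsymm, vec, ← mul_apply_eq_comp, hsqrt]
    _ = ((‖ρ.vec i‖ ^ 2 : ℝ) : ℂ) := by
        rw [inner_self_eq_norm_sq_to_K, Complex.ofReal_pow]
        rfl

lemma hasSum_norm_vec_sq : HasSum (fun i => ‖ρ.vec i‖ ^ 2) 1 := by
  have htrace := ρ.trace_eq_one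
  simp only [ρ.inner_op_basis, ← Complex.ofReal_one] at htrace
  exact Complex.hasSum_ofReal.1 htrace

lemma summable_norm_inner_vec_sq (f : H) : Summable fun i => ‖⟪f, ρ.vec i⟫_ℂ‖ ^ 2 := by
  refine (ρ.hasSum_norm_vec_sq.summable.mul_left (‖f‖ ^ 2)).of_nonneg_of_le
    (fun i => by positivity) fun i => ?_
  rw [← mul_pow]
  exact pow_le_pow_left₀ (norm_nonneg _) (norm_inner_le_norm _ _) 2

end DensityOperator

section Homodyne

variable {M : ℕ}

lemma bornMeasure_univ (φ : Wave M) : bornMeasure φ Set.univ = ENNReal.ofReal (‖φ‖ ^ 2) := by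
  rw [bornMeasure, withDensity_apply _ MeasurableSet.univ, Measure.restrict_univ,
    lintegral_norm_sq_of_ae_eq .rfl]

lemma vecHomodyne_univ (q : Quadrature) (k : Fin M) (φ : Wave M) :
    vecHomodyne q k φ Set.univ = ENNReal.ofReal (‖φ‖ ^ 2) := by
  cases q <;> simp only [vecHomodyne] <;>
    rw [Measure.map_apply (by fun_prop) MeasurableSet.univ, Set.preimage_univ, bornMeasure_univ] <;>
    simp only [Lp.norm_fourier_eq, chirp, norm_phase]

instance isProbabilityMeasure_homodyne (ρ : DensityOperator (Wave M)) (q : Quadrature)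
    (k : Fin M) : IsProbabilityMeasure (homodyne ρ q k) := by
  refine ⟨?_⟩
  rw [homodyne, Measure.sum_apply _ MeasurableSet.univ]
  simp only [vecHomodyne_univ]
  rw [← ENNReal.ofReal_tsum_of_nonneg (fun i => by positivity) ρ.hasSum_norm_vec_sq.summable,
    ρ.hasSum_norm_vec_sq.tsum_eq, ENNReal.ofReal_one]

end Homodyne

lemma memLp_two_of_lintegral_sq_lt_top {Ω : Type*} [MeasurableSpace Ω] {μ : Measure Ω}
    {f : Ω → ℝ} (hf : AEStronglyMeasurable f μ) (h : ∫⁻ t, ENNReal.ofReal (f t ^ 2) ∂μ < ⊤) :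
    MemLp f 2 μ := by
  rw [memLp_two_iff_integrable_sq hf]
  exact ⟨hf.pow 2, (hasFiniteIntegral_iff_ofReal (.of_forall fun t => sq_nonneg (f t))).2 h⟩

namespace FiniteEnergy

variable {M : ℕ} {E s : ℝ} {ρ : DensityOperator (Wave M)} (h : FiniteEnergy E ρ)
include h

lemma lintegral_vecHomodyne_lt_top (k : Fin M) (a : Fin 6) (i : basisIndex (Wave M)) :
    ∫⁻ v, ENNReal.ofReal ((v ^ deg a) ^ 2) ∂(vecHomodyne (quad a) k (ρ.vec i)) < ⊤ :=
  (lintegral_mono' (Measure.le_sum _ i) le_rfl).trans_lt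
    ((h k a).trans_lt ENNReal.ofReal_lt_top)

lemma integrable_pow (k : Fin M) (a : Fin 6) :
    Integrable (fun v : ℝ => v ^ deg a) (homodyne ρ (quad a) k) :=
  (memLp_two_of_lintegral_sq_lt_top (by fun_prop)
    ((h k a).trans_lt ENNReal.ofReal_lt_top)).integrable one_le_two

lemma hasSum_witnessValue (s γ : ℝ) :
    HasSum (fun i => (1 + (M : ℝ) / 2) * ‖ρ.vec i‖ ^ 2 + ∑ k : Fin M, modeWitness s γ k (ρ.vec i))
      (witnessValue s γ ρ) := by
  have hconst := ρ.hasSum_norm_vec_sq.mul_left (1 + (M : ℝ) / 2)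
  rw [mul_one] at hconst
  exact hconst.add (hasSum_sum fun k _ => hasSum_sum fun a _ =>
    (hasSum_integral_measure (h.integrable_pow k a)).mul_left _)

theorem witnessValue_le_tsum_norm_inner_sq (hs : 0 < s) (γ : ℝ) :
    witnessValue s γ ρ ≤ ∑' i, ‖⟪cubic s hs γ M, ρ.vec i⟫_ℂ‖ ^ 2 :=
  hasSum_le (fun i => add_sum_modeWitness_le_norm_inner_sq hs γ (ρ.vec i)
      fun k a => h.lintegral_vecHomodyne_lt_top k a i)
    (h.hasSum_witnessValue s γ) (ρ.summable_norm_inner_vec_sq _).hasSum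

end FiniteEnergy

namespace Circuit

variable {m M : ℕ} (A : Circuit m M)

instance sFinite_verdictLaw (s : ℝ) (hs : 0 < s) (γ : ℝ) (ρ : DensityOperator (Wave M)) :
    SFinite (A.verdictLaw s hs γ ρ) := by
  unfold verdictLaw
  infer_instance

lemma verdictLaw_incorrect_le {s : ℝ} (hs : 0 < s) (γ : ℝ) (ρ : DensityOperator (Wave M)) :
    A.verdictLaw s hs γ ρ {z | z.2 = false} ≤
      ENNReal.ofReal (1 - ∑' i, ‖⟪cubic s hs γ M, ρ.vec i⟫_ℂ‖ ^ 2) := by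
  have hmeas : MeasurableSet {z : Config M × Bool | z.2 = false} :=
    measurable_snd (measurableSet_singleton false)
  have hinfidelity := ρ.hasSum_norm_vec_sq.sub
    (ρ.summable_norm_inner_vec_sq (cubic s hs γ M)).hasSum
  have hnonneg (i) : 0 ≤ ‖ρ.vec i‖ ^ 2 - ‖⟪cubic s hs γ M, ρ.vec i⟫_ℂ‖ ^ 2 := by
    rw [sub_nonneg]
    refine pow_le_pow_left₀ (norm_nonneg _) ((norm_inner_le_norm _ _).trans ?_) 2
    rw [norm_cubic, one_mul]
  rw [verdictLaw, Measure.sum_apply _ hmeas, ← hinfidelity.tsum_eq,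
    ENNReal.ofReal_tsum_of_nonneg hnonneg hinfidelity.summable]
  refine ENNReal.tsum_le_tsum fun i => ?_
  rw [Measure.add_apply, Measure.map_apply (by fun_prop) hmeas,
    Measure.map_apply (by fun_prop) hmeas]
  simpa [withDensity_apply _ MeasurableSet.univ] using
    A.lintegral_incorrectPart_le hs γ (norm_cubic hs) (ρ.vec i)

end Circuit

/-! ### The verification test -/

section Chebyshev

open ProbabilityTheory

variable {Ω : Type*} [MeasurableSpace Ω] {μ : Measure Ω} [IsProbabilityMeasure μ] {X : Ω → ℝ}

lemma integral_sum_eval (hX : Integrable X μ) (N : ℕ) :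
    ∫ t, ∑ j, X (t j) ∂(Measure.pi fun _ : Fin N => μ) = N * ∫ v, X v ∂μ := by
  rw [integral_finsetSum _ fun j _ => integrable_comp_eval (μ := fun _ : Fin N => μ) hX]
  simp [integral_comp_eval (μ := fun _ : Fin N => μ) hX.1]

lemma measure_pi_add_le_sampleMean_le (hX : MemLp X 2 μ) {N : ℕ} (hN : 0 < N) {D : ℝ}
    (hD : 0 < D) :
    Measure.pi (fun _ : Fin N => μ) {t | ∫ v, X v ∂μ + D ≤ (1 / (N : ℝ)) * ∑ j, X (t j)} ≤
      ENNReal.ofReal (Var[X; μ] / (N * D ^ 2)) := by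
  have hN' : (0 : ℝ) < N := Nat.cast_pos.2 hN
  let S : (Fin N → Ω) → ℝ := ∑ j, fun t => X (t j)
  have hS : MemLp S 2 (Measure.pi fun _ => μ) := memLp_finsetSum' _ fun j _ =>
    hX.comp_measurePreserving (measurePreserving_eval (fun _ => μ) j)
  have hmean : ∫ t, S t ∂(Measure.pi fun _ => μ) = N * ∫ v, X v ∂μ := by
    simpa only [S, Finset.sum_apply] using integral_sum_eval (hX.integrable one_le_two) N
  have hvar : Var[S; Measure.pi fun _ => μ] = N * Var[X; μ] := by
    simp [S, variance_sum_pi (X := fun _ => X) fun _ => hX]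
  calc Measure.pi (fun _ : Fin N => μ) {t | ∫ v, X v ∂μ + D ≤ (1 / (N : ℝ)) * ∑ j, X (t j)}
      ≤ Measure.pi (fun _ => μ) {t | N * D ≤ |S t - ∫ t, S t ∂(Measure.pi fun _ => μ)|} := by
        refine measure_mono fun t ht => ?_
        rw [Set.mem_ofPred_eq, one_div, inv_mul_eq_div, le_div_iff₀ hN'] at ht
        rw [Set.mem_ofPred_eq, hmean]
        simp only [S, Finset.sum_apply]
        exact le_trans (by linarith) (le_abs_self _)
    _ ≤ ENNReal.ofReal (Var[S; Measure.pi fun _ => μ] / (N * D) ^ 2) :=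
        meas_ge_le_variance_div_sq hS (mul_pos hN' hD)
    _ = ENNReal.ofReal (Var[X; μ] / (N * D ^ 2)) := by
        rw [hvar]
        congr 1
        field_simp

end Chebyshev

section Trial

variable {s γ : ℝ} {M : ℕ}

lemma sum_abs_coeff_pos (hs : 0 < s) (γ : ℝ) : 0 < ∑ a, |coeff s γ a| :=
  Finset.sum_pos' (fun a _ => abs_nonneg _) ⟨0, Finset.mem_univ _, by simp [coeff, hs]⟩

lemma totalWeight_eq (s γ : ℝ) (M : ℕ) : totalWeight s γ M = M * ∑ a, |coeff s γ a| := by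
  simp [totalWeight]

lemma totalWeight_pos (hs : 0 < s) (γ : ℝ) (hM : 0 < M) : 0 < totalWeight s γ M := by
  rw [totalWeight_eq]
  exact mul_pos (Nat.cast_pos.2 hM) (sum_abs_coeff_pos hs γ)

lemma sum_ofReal_abs_coeff_div_totalWeight (hs : 0 < s) (γ : ℝ) (hM : 0 < M) :
    ∑ a : Fin M × Fin 6, ENNReal.ofReal (|coeff s γ a.2| / totalWeight s γ M) = 1 := by
  have hΛ := totalWeight_pos hs γ hM
  rw [← ENNReal.ofReal_sum_of_nonneg fun a _ => by positivity, ← Finset.sum_div,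
    Fintype.sum_prod_type, ← ENNReal.ofReal_one]
  exact congrArg _ (div_self hΛ.ne')

lemma isProbabilityMeasure_trialLaw (hs : 0 < s) (γ : ℝ) (hM : 0 < M)
    (ρ : DensityOperator (Wave M)) : IsProbabilityMeasure (trialLaw s γ ρ) := by
  have huniv (a : Fin M × Fin 6) :
      (homodyne ρ (quad a.2) a.1).map (fun v => (a, v)) Set.univ = 1 := by
    rw [Measure.map_apply (by fun_prop) MeasurableSet.univ, Set.preimage_univ, measure_univ]
  refine ⟨?_⟩
  rw [trialLaw, Measure.finsetSum_apply]
  simp only [Measure.smul_apply, huniv, smul_eq_mul, mul_one,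
    sum_ofReal_abs_coeff_div_totalWeight hs γ hM]

lemma isProbabilityMeasure_testLaw (hs : 0 < s) (γ : ℝ) (hM : 0 < M) (N : ℕ)
    (ρ : DensityOperator (Wave M)) : IsProbabilityMeasure (testLaw s γ N ρ) := by
  have := isProbabilityMeasure_trialLaw hs γ hM ρ
  unfold testLaw
  infer_instance

/-- The summand `Λ sign(λ) f` that one trial contributes to the sample mean in `estimate`. -/
def trialValue (s γ : ℝ) {M : ℕ} (t : Trial M) : ℝ :=
  totalWeight s γ M * SignType.sign (coeff s γ t.1.2) * t.2 ^ deg t.1.2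

lemma estimate_eq {N : ℕ} (t : Fin N → Trial M) :
    estimate s γ t = 1 + (M : ℝ) / 2 + (1 / (N : ℝ)) * ∑ j, trialValue s γ (t j) := rfl

lemma measurable_trialValue (s γ : ℝ) (M : ℕ) :
    Measurable (trialValue s γ : Trial M → ℝ) :=
  measurable_from_prod_countable_right fun a => by
    simp only [trialValue]
    fun_prop

lemma measurable_estimate (s γ : ℝ) (M N : ℕ) :
    Measurable (estimate s γ : (Fin N → Trial M) → ℝ) := by
  have := measurable_trialValue s γ M
  simp only [funext estimate_eq]
  fun_prop

lemma trialValue_sq_le (t : Trial M) :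
    trialValue s γ t ^ 2 ≤ totalWeight s γ M ^ 2 * (t.2 ^ deg t.1.2) ^ 2 := by
  have hsign : ((SignType.sign (coeff s γ t.1.2) : ℝ)) ^ 2 ≤ 1 := by
    rcases lt_trichotomy (coeff s γ t.1.2) 0 with h | h | h <;> simp [h]
  rw [trialValue, mul_pow, mul_pow]
  exact mul_le_mul_of_nonneg_right (mul_le_of_le_one_right (sq_nonneg _) hsign) (sq_nonneg _)

namespace FiniteEnergy

variable {E : ℝ} {ρ : DensityOperator (Wave M)} (h : FiniteEnergy E ρ)
include h

lemma lintegral_map_trialValue_sq_le (s γ : ℝ) (a : Fin M × Fin 6) :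
    ∫⁻ t, ENNReal.ofReal (trialValue s γ t ^ 2)
      ∂((homodyne ρ (quad a.2) a.1).map fun v => (a, v)) ≤
        ENNReal.ofReal (totalWeight s γ M ^ 2 * |E|) := by
  have hmeas := ((measurable_trialValue s γ M).pow_const 2).ennreal_ofReal
  rw [lintegral_map hmeas (by fun_prop)]
  calc ∫⁻ v, ENNReal.ofReal (trialValue s γ (a, v) ^ 2) ∂(homodyne ρ (quad a.2) a.1)
      ≤ ∫⁻ v, ENNReal.ofReal (totalWeight s γ M ^ 2) * ENNReal.ofReal ((v ^ deg a.2) ^ 2)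
          ∂(homodyne ρ (quad a.2) a.1) := by
        refine lintegral_mono fun v => ?_
        rw [← ENNReal.ofReal_mul (sq_nonneg _)]
        exact ENNReal.ofReal_le_ofReal (trialValue_sq_le (a, v))
    _ ≤ ENNReal.ofReal (totalWeight s γ M ^ 2 * |E|) := by
        rw [lintegral_const_mul _ (by fun_prop), ENNReal.ofReal_mul (sq_nonneg _)]
        gcongr
        exact (h a.1 a.2).trans (ENNReal.ofReal_le_ofReal (le_abs_self E))

lemma lintegral_trialValue_sq_le (hs : 0 < s) (γ : ℝ) (hM : 0 < M) :
    ∫⁻ t, ENNReal.ofReal (trialValue s γ t ^ 2) ∂(trialLaw s γ ρ) ≤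
      ENNReal.ofReal (totalWeight s γ M ^ 2 * |E|) := by
  rw [trialLaw, lintegral_finsetSum_measure]
  simp only [lintegral_smul_measure, smul_eq_mul]
  refine (Finset.sum_le_sum fun a _ => mul_le_mul_right
    (h.lintegral_map_trialValue_sq_le s γ a) _).trans_eq ?_
  rw [← Finset.sum_mul, sum_ofReal_abs_coeff_div_totalWeight hs γ hM, one_mul]

lemma memLp_trialValue (hs : 0 < s) (γ : ℝ) (hM : 0 < M) :
    MemLp (trialValue s γ) 2 (trialLaw s γ ρ) :=
  memLp_two_of_lintegral_sq_lt_top (measurable_trialValue s γ M).aestronglyMeasurable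
    ((h.lintegral_trialValue_sq_le hs γ hM).trans_lt ENNReal.ofReal_lt_top)

open ProbabilityTheory in
lemma variance_trialValue_le (hs : 0 < s) (γ : ℝ) (hM : 0 < M) :
    Var[trialValue s γ; trialLaw s γ ρ] ≤ totalWeight s γ M ^ 2 * |E| := by
  have := isProbabilityMeasure_trialLaw hs γ hM ρ
  have hmeas := (measurable_trialValue s γ M).aestronglyMeasurable (μ := trialLaw s γ ρ)
  refine (variance_le_expectation_sq hmeas).trans ?_
  simp only [Pi.pow_apply]
  rw [integral_eq_lintegral_of_nonneg_ae (.of_forall fun t => sq_nonneg _) (hmeas.pow 2)]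
  exact ENNReal.toReal_le_of_le_ofReal (by positivity) (h.lintegral_trialValue_sq_le hs γ hM)

lemma integrable_map_trialValue (s γ : ℝ) (a : Fin M × Fin 6) :
    Integrable (trialValue s γ) ((homodyne ρ (quad a.2) a.1).map fun v => (a, v)) := by
  rw [integrable_map_measure (measurable_trialValue s γ M).aestronglyMeasurable (by fun_prop)]
  exact (h.integrable_pow a.1 a.2).const_mul
    (totalWeight s γ M * SignType.sign (coeff s γ a.2) : ℝ)

end FiniteEnergy

lemma integral_smul_map_trialValue (hs : 0 < s) (γ : ℝ) (hM : 0 < M)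
    (ρ : DensityOperator (Wave M)) (a : Fin M × Fin 6) :
    ∫ t, trialValue s γ t ∂(ENNReal.ofReal (|coeff s γ a.2| / totalWeight s γ M) •
        (homodyne ρ (quad a.2) a.1).map fun v => (a, v)) =
      coeff s γ a.2 * ∫ v, v ^ deg a.2 ∂(homodyne ρ (quad a.2) a.1) := by
  have hΛ := totalWeight_pos hs γ hM
  have hweight : |coeff s γ a.2| / totalWeight s γ M *
      (totalWeight s γ M * SignType.sign (coeff s γ a.2)) = coeff s γ a.2 := by
    rw [← mul_assoc, div_mul_cancel₀ _ hΛ.ne', abs_mul_sign]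
  rw [integral_smul_measure, integral_map (by fun_prop)
      (measurable_trialValue s γ M).aestronglyMeasurable, ENNReal.toReal_ofReal (by positivity)]
  simp only [trialValue]
  rw [integral_const_mul, smul_eq_mul, ← mul_assoc, hweight]

/-- Importance sampling is unbiased. -/
lemma FiniteEnergy.witnessValue_eq {E : ℝ} {ρ : DensityOperator (Wave M)}
    (h : FiniteEnergy E ρ) (hs : 0 < s) (γ : ℝ) (hM : 0 < M) :
    witnessValue s γ ρ = 1 + (M : ℝ) / 2 + ∫ t, trialValue s γ t ∂(trialLaw s γ ρ) := by
  rw [trialLaw, integral_finsetSum_measure fun a _ =>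
    (h.integrable_map_trialValue s γ a).smul_measure ENNReal.ofReal_ne_top]
  simp only [integral_smul_map_trialValue hs γ hM]
  rw [Fintype.sum_prod_type, witnessValue]

end Trial

section Acceptance

variable {s γ E F_T η β : ℝ} {M N : ℕ} {ρ : DensityOperator (Wave M)}

lemma FiniteEnergy.testLaw_accepts_le (h : FiniteEnergy E ρ) (hs : 0 < s) (hM : 0 < M)
    (hN : 0 < N) (hw : witnessValue s γ ρ < F_T + η) :
    testLaw s γ N ρ {t | Accepts s γ F_T η t} ≤ ENNReal.ofReal
      (totalWeight s γ M ^ 2 * |E| / (N * (F_T + η - witnessValue s γ ρ) ^ 2)) := by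
  have := isProbabilityMeasure_trialLaw hs γ hM ρ
  have hmean := h.witnessValue_eq hs γ hM
  have hsub : {t : Fin N → Trial M | Accepts s γ F_T η t} ⊆
      {t | ∫ v, trialValue s γ v ∂(trialLaw s γ ρ) + (F_T + η - witnessValue s γ ρ) ≤
        (1 / (N : ℝ)) * ∑ j, trialValue s γ (t j)} := fun t ht => by
    rw [Set.mem_ofPred_eq, Accepts, estimate_eq] at ht
    rw [Set.mem_ofPred_eq]
    linarith
  refine (measure_mono hsub).trans ((measure_pi_add_le_sampleMean_le
    (h.memLp_trialValue hs γ hM) hN (sub_pos.2 hw)).trans (ENNReal.ofReal_le_ofReal ?_))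
  gcongr
  exact h.variance_trialValue_le hs γ hM

lemma TestAccurate.testLaw_accepts_le (hT : TestAccurate s γ E η β M N) (h : FiniteEnergy E ρ)
    (hs : 0 < s) (hM : 0 < M) (hβ : β ≤ 1) (hw : witnessValue s γ ρ ≤ F_T) :
    testLaw s γ N ρ {t | Accepts s γ F_T η t} ≤ ENNReal.ofReal β := by
  have := isProbabilityMeasure_testLaw hs γ hM N ρ
  let accurate : Set (Fin N → Trial M) := {t | |estimate s γ t - witnessValue s γ ρ| < η}
  have hmeas : MeasurableSet accurate :=
    measurableSet_lt ((measurable_estimate s γ M N).sub_const _).abs measurable_const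
  have hsub : {t : Fin N → Trial M | Accepts s γ F_T η t} ⊆ accurateᶜ := fun t ht => by
    rw [Set.mem_ofPred_eq, Accepts] at ht
    simp only [accurate, Set.mem_compl_iff, Set.mem_ofPred_eq, not_lt]
    exact le_trans (by linarith) (le_abs_self _)
  calc testLaw s γ N ρ {t | Accepts s γ F_T η t} ≤ testLaw s γ N ρ accurateᶜ := measure_mono hsub
    _ = 1 - testLaw s γ N ρ accurate := prob_compl_eq_one_sub hmeas
    _ ≤ 1 - ENNReal.ofReal (1 - β) := tsub_le_tsub_left (hT ρ h) _
    _ = ENNReal.ofReal β := by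
        rw [← ENNReal.ofReal_one, ← ENNReal.ofReal_sub _ (by linarith), sub_sub_cancel]

end Acceptance

lemma div_sq_mul_one_sub_le {F_T η w v : ℝ} (hη : 0 < η) (hηF : η ≤ 2 * (1 - F_T)) (hw : w ≤ F_T)
    (hv : v ≤ η ^ 2) : v / (F_T + η - w) ^ 2 * (1 - w) ≤ 1 - F_T := by
  have hu : 0 ≤ F_T - w := sub_nonneg.2 hw
  have hτ : 0 ≤ 1 - F_T := by linarith
  have hD : 0 < F_T + η - w := by linarith
  rw [div_mul_eq_mul_div, div_le_iff₀ (by positivity)]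
  calc v * (1 - w) ≤ η ^ 2 * (1 - w) := mul_le_mul_of_nonneg_right hv (by linarith)
    _ = (1 - F_T) * η ^ 2 + η * (F_T - w) * η := by ring
    _ ≤ (1 - F_T) * η ^ 2 + η * (F_T - w) * (2 * (1 - F_T)) + (1 - F_T) * (F_T - w) ^ 2 := by
        have := mul_le_mul_of_nonneg_left hηF (mul_nonneg hη.le hu)
        linarith [mul_nonneg hτ (sq_nonneg (F_T - w))]
    _ = (1 - F_T) * (F_T + η - w) ^ 2 := by ring

namespace Circuit

variable {m M N : ℕ} (A : Circuit m M) {s γ E F_T η β : ℝ} {ρ : DensityOperator (Wave M)}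

lemma runLaw_le (hs : 0 < s) (F_T η : ℝ) (N : ℕ) (h : FiniteEnergy E ρ) :
    A.runLaw s hs γ N ρ {z | Accepts s γ F_T η z.1 ∧ z.2.2 = false} ≤
      testLaw s γ N ρ {t | Accepts s γ F_T η t} *
        ENNReal.ofReal (min 1 (1 - witnessValue s γ ρ)) := by
  have hset : {z : (Fin N → Trial M) × (Config M × Bool) |
      Accepts s γ F_T η z.1 ∧ z.2.2 = false} =
      {t | Accepts s γ F_T η t} ×ˢ {z | z.2 = false} := rfl
  have hfidelity : 0 ≤ ∑' i, ‖⟪cubic s hs γ M, ρ.vec i⟫_ℂ‖ ^ 2 :=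
    tsum_nonneg fun i => by positivity
  rw [runLaw, hset, Measure.prod_prod]
  gcongr
  refine (A.verdictLaw_incorrect_le hs γ ρ).trans (ENNReal.ofReal_le_ofReal (le_min ?_ ?_))
  · linarith
  · linarith [h.witnessValue_le_tsum_norm_inner_sq hs γ]

lemma runLaw_le_of_le_witnessValue (hs : 0 < s) (hM : 0 < M) (h : FiniteEnergy E ρ)
    (hw : F_T ≤ witnessValue s γ ρ) :
    A.runLaw s hs γ N ρ {z | Accepts s γ F_T η z.1 ∧ z.2.2 = false} ≤
      ENNReal.ofReal (1 - F_T) := by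
  have := isProbabilityMeasure_testLaw hs γ hM N ρ
  refine (A.runLaw_le hs F_T η N h).trans ((mul_le_of_le_one_left zero_le prob_le_one).trans ?_)
  exact ENNReal.ofReal_le_ofReal ((min_le_right _ _).trans (by linarith))

lemma runLaw_le_of_witnessValue_le (hs : 0 < s) (hM : 0 < M) (h : FiniteEnergy E ρ)
    (hη : 0 < η) (hηF : η ≤ 2 * (1 - F_T))
    (hN : ((∑ a, |coeff s γ a|) ^ 2 * |E| + 1) * ((M : ℝ) ^ 2 / η ^ 2) ≤ N)
    (hw : witnessValue s γ ρ ≤ F_T) :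
    A.runLaw s hs γ N ρ {z | Accepts s γ F_T η z.1 ∧ z.2.2 = false} ≤
      ENNReal.ofReal (1 - F_T) := by
  have hM' : (0 : ℝ) < M := Nat.cast_pos.2 hM
  have hN' : (0 : ℝ) < N := lt_of_lt_of_le (by positivity) hN
  have hV : totalWeight s γ M ^ 2 * |E| / N ≤ η ^ 2 := by
    rw [← mul_div_assoc, div_le_iff₀ (by positivity)] at hN
    rw [div_le_iff₀ hN', totalWeight_eq]
    linarith [sq_nonneg (M : ℝ)]
  calc A.runLaw s hs γ N ρ {z | Accepts s γ F_T η z.1 ∧ z.2.2 = false}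
      ≤ ENNReal.ofReal (totalWeight s γ M ^ 2 * |E| /
          (N * (F_T + η - witnessValue s γ ρ) ^ 2)) * ENNReal.ofReal (1 - witnessValue s γ ρ) :=
        (A.runLaw_le hs F_T η N h).trans <| mul_le_mul'
          (h.testLaw_accepts_le hs hM (Nat.cast_pos.1 hN') (by linarith))
          (ENNReal.ofReal_le_ofReal (min_le_right _ _))
    _ ≤ ENNReal.ofReal (1 - F_T) := by
        rw [← ENNReal.ofReal_mul (by positivity), ← div_div]
        exact ENNReal.ofReal_le_ofReal (div_sq_mul_one_sub_le hη hηF hw hV)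

lemma runLaw_le_of_testAccurate (hs : 0 < s) (hM : 0 < M) (h : FiniteEnergy E ρ)
    (hT : TestAccurate s γ E η β M N) (hβ : β ≤ 1) (hw : witnessValue s γ ρ ≤ F_T) :
    A.runLaw s hs γ N ρ {z | Accepts s γ F_T η z.1 ∧ z.2.2 = false} ≤ ENNReal.ofReal β :=
  (A.runLaw_le hs F_T η N h).trans <| (mul_le_of_le_one_right zero_le
    (ENNReal.ofReal_le_one.2 (min_le_left _ _))).trans (hT.testLaw_accepts_le h hs hM hβ hw)

end Circuit

lemma one_le_log_eight_div {β : ℝ} (hβ₀ : 0 < β) (hβ₁ : β ≤ 1) : 1 ≤ Real.log (8 / β) := by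
  rw [Real.le_log_iff_exp_le (by positivity), le_div_iff₀ hβ₀]
  nlinarith [Real.exp_one_lt_d9, Real.exp_pos 1]

end CVVerify

end

theorem theorem2_general (s : ℝ) (hs : 0 < s) (γ : ℝ) (E : ℝ) :
    ∃ C : ℝ, 0 < C ∧ ∀ (m M N : ℕ) (A : CVVerify.Circuit m M) (F_T η β : ℝ),
      0 < M → 0 ≤ F_T → 0 ≤ β → β ≤ 1 → 0 < η → η ≤ 2 * (1 - F_T) →
      (C * ((M : ℝ) ^ 2 / η ^ 2) ≤ (N : ℝ) ∨ CVVerify.TestAccurate s γ E η β M N) →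
      A.IsVerifiable s hs γ F_T η N E (1 - (1 - β) * F_T) := by
  refine ⟨(∑ a, |CVVerify.coeff s γ a|) ^ 2 * |E| + 1, by positivity, ?_⟩
  intro m M N A F_T η β hM hF₀ hβ₀ hβ₁ hη hηF hN
  have hF₁ : F_T ≤ 1 := by linarith
  have hε : 1 - F_T ≤ 1 - (1 - β) * F_T := by linarith [mul_nonneg hβ₀ hF₀]
  have hβε : β ≤ 1 - (1 - β) * F_T := by
    linarith [mul_nonneg (sub_nonneg.2 hβ₁) (sub_nonneg.2 hF₁)]
  have hε₁ : 0 ≤ (1 - β) * F_T := mul_nonneg (sub_nonneg.2 hβ₁) hF₀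
  refine ⟨hβ₀.trans hβε, by linarith, fun ρ h => ?_⟩
  rcases le_total F_T (CVVerify.witnessValue s γ ρ) with hw | hw
  · exact (A.runLaw_le_of_le_witnessValue hs hM h hw).trans (ENNReal.ofReal_le_ofReal hε)
  rcases hN with hN | hT
  · exact (A.runLaw_le_of_witnessValue_le hs hM h hη hηF hN hw).trans
      (ENNReal.ofReal_le_ofReal hε)
  · exact (A.runLaw_le_of_testAccurate hs hM h hT hβ₁ hw).trans (ENNReal.ofReal_le_ofReal hβε)

theorem theorem2 (s : ℝ) (hs : 0 < s) (γ : ℝ) (E : ℝ) :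
    ∃ C : ℝ, 0 < C ∧ ∀ (m M N : ℕ) (A : CVVerify.Circuit m M) (F_T η β : ℝ),
      0 < M → 0 < F_T → F_T < 1 → 0 < β → β < 1 → 0 < η → η ≤ (1 - F_T) / 2 →
      (C * ((M : ℝ) ^ 2 / η ^ 2) * Real.log (8 / β) ≤ (N : ℝ) ∨
        CVVerify.TestAccurate s γ E η β M N) →
      A.IsVerifiable s hs γ F_T η N E (1 - (1 - β) * F_T) := by
  obtain ⟨C, hC, h⟩ := theorem2_general s hs γ E
  exact ⟨C, hC, fun m M N A F_T η β hM hF₀ _ hβ₀ hβ₁ hη hηF hN =>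
    h m M N A F_T η β hM hF₀.le hβ₀.le hβ₁.le hη (by linarith) <| hN.imp_left
      (le_mul_of_one_le_right (by positivity) (CVVerify.one_le_log_eight_div hβ₀ hβ₁.le)).trans⟩
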